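/- Throughout, $A$ is a unital $^*$-algebra over $\mathbb C$, $D, D_1, D_2$ denote C$^*$-algebras (possibly non-unital), and Hilbert modules are right Hilbert modules with $D$-valued inner product that is conjugate-linear in the first variable. **Representations.** A representation $\pi$ of $A$ on a Hilbert $D$-module $\mathcal E$ consists of a dense (not necessarily closed) $D$-submodule $\mathfrak E\subseteq\mathcal E$ and a unital algebra homomorphism $\pi$ from $A$ to the $D$-module endomorphisms of $\mathfrak E$ with $\langle \xi,\pi(a)\eta\rangle=\langle\pi(a^*)\xi,\eta\rangle$ for all $a\in A$, $\xi,\eta\in\mathfrak E$. It is closed if $\mathfrak E$ is complete in the graph topology, which is defined by the seminorms $\xi\mapsto\|\pi(a)\xi\|$, $a\in A$; every representation has a closure. Let $\mathrm{Rep}(A)$ be the class of all closed representations of $A$ on Hilbert modules over C$^*$-algebras. A unitary $^*$-intertwiner between $\pi_1$ and $\pi_2$ on Hilbert $D$-modules is a $D$-linear unitary $u\colon\mathcal E_1\to\mathcal E_2$ with $u(\mathfrak E_1)=\mathfrak E_2$ and $u\,\pi_1(a)\xi=\pi_2(a)\,u\xi$ for all $a\in A$, $\xi\in\mathfrak E_1$.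 A correspondence from $D_1$ to $D_2$ is a Hilbert $D_2$-module $\mathcal G$ with a nondegenerate $^*$-homomorphism from $D_1$ to the adjointable operators on $\mathcal G$. For such $\mathcal G$ and a representation $\pi$ on a Hilbert $D_1$-module $\mathcal E$, let $\pi\otimes_{D_1}\mathcal G$ be the closure of the representation $a\mapsto\pi(a)\otimes 1$ on the image of the algebraic tensor product $\mathfrak E\odot\mathcal G$ in the interior tensor product $\mathcal E\otimes_{D_1}\mathcal G$. A nondegenerate representation $\varrho\colon D\to\mathbb B(\mathcal H)$ on a Hilbert space is a correspondence from $D$ to $\mathbb C$, and the resulting representation is denoted $\pi\otimes_\varrho 1$. The direct sum $\bigoplus\pi_i$ of representations on Hilbert $D$-modules $\mathcal E_i$ is the closure of the obvious representation on the algebraic direct sum of the domains, inside the Hilbert module direct sum $\bigoplus\mathcal E_i$. **Weak admissibility.** A class $\mathrm{Rep}'(A)\subseteq\mathrm{Rep}(A)$ is weakly admissible if it is closed under unitary $^*$-intertwiners (if $\pi_1$ belongs to it and there is a unitary $^*$-intertwiner from $\pi_1$ to $\pi_2$, then $\pi_2$ belongs to it), under $\pi\mapsto\pi\otimes_{D_1}\mathcal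 G$ for all correspondences $\mathcal G$, and if $\bigoplus\pi_i$ belongs to it if and only if all $\pi_i$ do. **Submodule conditions.** Let $n\ge1$. A natural construction of Hilbert submodules of rank $n$ for a class $\mathrm{Rep}'(A)$ associates to each $\pi$ in $\mathrm{Rep}'(A)$ on a Hilbert module $\mathcal E$ a closed submodule $\mathcal F(\pi)\subseteq\mathcal E^n$, such that (for representations in $\mathrm{Rep}'(A)$) 1. $u^{\oplus n}(\mathcal F(\pi_1))=\mathcal F(\pi_2)$ for each unitary $^*$-intertwiner $u$ between $\pi_1$ and $\pi_2$; 2. for each correspondence $\mathcal G$ from $D_1$ to $D_2$, the canonical isomorphism $\mathcal E^n\otimes_{D_1}\mathcal G\cong(\mathcal E\otimes_{D_1}\mathcal G)^n$ maps $\mathcal F(\pi)\otimes_{D_1}\mathcal G$ onto $\mathcal F(\pi\otimes_{D_1}\mathcal G)$; 3. the canonical isomorphism $(\bigoplus\mathcal E_i)^n\cong\bigoplus\mathcal E_i^n$ maps $\mathcal F(\bigoplus\pi_i)$ onto $\bigoplus\mathcal F(\pi_i)$. A subclass $\mathrm{Rep}''(A)\subseteq\mathrm{Rep}'(A)$ is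 defined by a submodule condition if there are two natural constructions $\mathcal F_1,\mathcal F_2$ of Hilbert submodules of the same rank for $\mathrm{Rep}'(A)$ such that $\pi$ in $\mathrm{Rep}'(A)$ belongs to $\mathrm{Rep}''(A)$ if and only if $\mathcal F_1(\pi)=\mathcal F_2(\pi)$. A class $\mathrm{Rep}_{\mathrm{int}}(A)\subseteq\mathrm{Rep}(A)$ of "integrable" representations is defined by submodule conditions if there are a well-ordered set $I$ with least element $0$ and greatest element $M$ and classes $\mathrm{Rep}^i(A)\subseteq\mathrm{Rep}(A)$ for $i\in I$ such that $\mathrm{Rep}^0(A)=\mathrm{Rep}(A)$ and $\mathrm{Rep}^M(A)=\mathrm{Rep}_{\mathrm{int}}(A)$; $\mathrm{Rep}^{i+1}(A)\subseteq\mathrm{Rep}^i(A)$ is defined by a submodule condition whenever $i\in I$ has a successor $i+1$; and $\mathrm{Rep}^i(A)=\bigcap_{i'<i}\mathrm{Rep}^{i'}(A)$ whenever $i\ne0$ is not a successor. **Theorem.** Let $\mathrm{Rep}_{\mathrm{int}}(A)\subseteq\mathrm{Rep}(A)$ be defined by submodule conditions. Then it satisfies the Strong Local–Global Principle, that is, $\mathrm{Rep}_{\mathrm{int}}(A)$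 is weakly admissible, and a closed representation $\pi$ of $A$ on a Hilbert $D$-module $\mathcal E$ belongs to $\mathrm{Rep}_{\mathrm{int}}(A)$ if and only if $\pi\otimes_\varrho1$ belongs to $\mathrm{Rep}_{\mathrm{int}}(A)$ for all irreducible Hilbert space representations $\varrho\colon D\to\mathbb B(\mathcal H)$. -/

import Mathlib

open scoped TensorProduct

universe u v w

noncomputable section

namespace StarRep

/-- A (right) Hilbert `D`-module over the C⋆-algebra `D`: a complex vector space with a right action
`act x d = x · d` of `D` and a `D`-valued inner product that is conjugate-linear in the first and
linear in the second variable, complete in the norm `‖x‖ = ‖⟨x, x⟩‖ ^ (1/2)`. Positivity of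
`⟨x, x⟩` is expressed as `⟨x, x⟩ = b⋆b`. (The class `CStarModule` of Mathlib is not used here because
its axiom `⟨x, d • y⟩ = d * ⟨x, y⟩` describes left modules, whereas interior tensor products with
correspondences are formed with right modules.) -/
structure HilbertModule (D : Type u) [NonUnitalCStarAlgebra D] : Type (u + 1) where
  carrier : Type u
  [group : NormedAddCommGroup carrier]
  [space : NormedSpace ℂ carrier]
  [complete : CompleteSpace carrier]
  act : carrier →ₗ[ℂ] D →ₗ[ℂ] carrier
  inner : carrier →ₗ⋆[ℂ] carrier →ₗ[ℂ] D
  act_mul : ∀ x d e, act x (d * e) = act (act x d) e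
  inner_act : ∀ x y d, inner x (act y d) = inner x y * d
  star_inner : ∀ x y, star (inner x y) = inner y x
  inner_self_nonneg : ∀ x, ∃ b : D, inner x x = star b * b
  inner_self_eq_zero : ∀ x, inner x x = 0 → x = 0
  norm_sq : ∀ x, ‖x‖ ^ 2 = ‖inner x x‖

namespace HilbertModule

instance {D : Type u} [NonUnitalCStarAlgebra D] : CoeSort (HilbertModule D) (Type u) :=
  ⟨HilbertModule.carrier⟩

attribute [instance] HilbertModule.group HilbertModule.space HilbertModule.complete

end HilbertModule

/-- A `D`-valued positive semidefinite inner product on a complex vector space `X` with a right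
action of `D`. -/
structure PreHilbertModule (D : Type u) [NonUnitalCStarAlgebra D] (X : Type u) [AddCommGroup X]
    [Module ℂ X] where
  act : X → D → X
  inner : X →ₗ⋆[ℂ] X →ₗ[ℂ] D
  inner_act : ∀ x y d, inner x (act y d) = inner x y * d
  star_inner : ∀ x y, star (inner x y) = inner y x
  inner_self_nonneg : ∀ x, ∃ b : D, inner x x = star b * b

namespace PreHilbertModule

variable {D : Type u} [NonUnitalCStarAlgebra D] {X : Type u} [AddCommGroup X] [Module ℂ X]
  (S : PreHilbertModule D X)

theorem inner_act_left (x y : X) (d : D) : S.inner (S.act x d) y = star d * S.inner x y := by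
  rw [← S.star_inner, S.inner_act, star_mul, S.star_inner]

theorem cauchySchwarz (x y : X) :
    ‖S.inner x y‖ ^ 2 ≤ ‖S.inner x x‖ * ‖S.inner y y‖ := by
  let _ : PartialOrder D := CStarAlgebra.spectralOrder D
  have _ : StarOrderedRing D := CStarAlgebra.spectralOrderedRing D
  have key : ∀ N : ℝ, 0 < N → ‖S.inner x x‖ ≤ N →
      ‖S.inner x y‖ ^ 2 ≤ N * ‖S.inner y y‖ := by
    intro N hN hx
    set a := S.inner x y with ha
    have ha' : S.inner y x = star a := by rw [ha, S.star_inner]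
    have hsa : IsSelfAdjoint (S.inner x x) := S.star_inner x x
    have h0 : 0 ≤ S.inner (S.act x a - (N : ℂ) • y) (S.act x a - (N : ℂ) • y) :=
      CStarAlgebra.nonneg_iff_eq_star_mul_self.2 (S.inner_self_nonneg _)
    have e : S.inner (S.act x a - (N : ℂ) • y) (S.act x a - (N : ℂ) • y) =
        star a * S.inner x x * a - N • (star a * a) - N • (star a * a)
          + N • (N • S.inner y y) := by
      simp only [map_sub, LinearMap.sub_apply, S.inner_act, S.inner_act_left, map_smul,
        LinearMap.map_smulₛₗ, LinearMap.smul_apply, ha', Complex.conj_ofReal, ← ha]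
      simp only [Complex.coe_smul, smul_sub, mul_assoc]
      abel
    rw [e] at h0
    have h1 : star a * S.inner x x * a ≤ N • (star a * a) := by
      refine (CStarAlgebra.star_left_conjugate_le_norm_smul hsa).trans ?_
      exact smul_le_smul_of_nonneg_right hx (star_mul_self_nonneg a)
    have h2 : N • (star a * a) ≤ N • (N • S.inner y y) := by
      rw [← sub_nonneg]
      refine h0.trans ?_
      rw [← sub_nonneg]
      have : N • N • S.inner y y - N • (star a * a) -
          (star a * S.inner x x * a - N • (star a * a) - N • (star a * a)
          + N • (N • S.inner y y)) = N • (star a * a) - star a * S.inner x x * a := by abel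
      rw [this]
      exact sub_nonneg.2 h1
    have h3 : star a * a ≤ N • S.inner y y := by
      rwa [smul_le_smul_iff_of_pos_left hN] at h2
    have h4 := CStarAlgebra.norm_le_norm_of_nonneg_of_le (star_mul_self_nonneg a) h3
    rw [CStarRing.norm_star_mul_self, norm_smul, Real.norm_of_nonneg hN.le] at h4
    rwa [sq]
  refine le_of_forall_pos_le_add fun ε hε => ?_
  have hp : 0 < ‖S.inner y y‖ + 1 := by positivity
  have := key (‖S.inner x x‖ + ε / (‖S.inner y y‖ + 1)) (by positivity)
    (le_add_of_nonneg_right (by positivity))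
  refine this.trans ?_
  rw [add_mul]
  gcongr
  rw [div_mul_eq_mul_div, div_le_iff₀ hp]
  gcongr
  linarith

theorem inner_smul_self (c : ℂ) (x : X) :
    S.inner (c • x) (c • x) = (star c * c) • S.inner x x := by
  rw [map_smul, LinearMap.map_smulₛₗ, LinearMap.smul_apply, smul_smul, mul_comm]
  rfl

theorem inner_add_self (x y : X) :
    S.inner (x + y) (x + y) = S.inner x x + S.inner x y + S.inner y x + S.inner y y := by
  simp only [map_add, LinearMap.add_apply]
  abel

/-- The vector space `X` equipped with the seminorm `‖x‖ = ‖⟨x, x⟩‖ ^ (1/2)`. -/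
def Space (_S : PreHilbertModule D X) : Type u := X

instance : AddCommGroup S.Space := inferInstanceAs (AddCommGroup X)
instance : Module ℂ S.Space := inferInstanceAs (Module ℂ X)
instance : Norm S.Space := ⟨fun x => √‖S.inner x x‖⟩

/-- The inner product and the action, on `S.Space`. -/
def sinner : S.Space →ₗ⋆[ℂ] S.Space →ₗ[ℂ] D := S.inner

/-- The right action, on `S.Space`. -/
def sact : S.Space → D → S.Space := S.act

theorem norm_sq (x : S.Space) : ‖x‖ ^ 2 = ‖S.sinner x x‖ :=
  Real.sq_sqrt (norm_nonneg _)

theorem norm_inner_le (x y : S.Space) : ‖S.sinner x y‖ ≤ ‖x‖ * ‖y‖ := by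
  have hx : 0 ≤ ‖x‖ := Real.sqrt_nonneg _
  have hy : 0 ≤ ‖y‖ := Real.sqrt_nonneg _
  refine le_of_sq_le_sq ?_ (mul_nonneg hx hy)
  rw [mul_pow, S.norm_sq, S.norm_sq]
  exact S.cauchySchwarz x y

theorem core : SeminormedSpace.Core ℂ S.Space where
  norm_nonneg _ := Real.sqrt_nonneg _
  norm_smul c x := by
    have h : ∀ y : X, √‖S.inner (c • y) (c • y)‖ = ‖c‖ * √‖S.inner y y‖ := fun y => by
      rw [S.inner_smul_self c y, norm_smul, CStarRing.norm_star_mul_self,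
        Real.sqrt_mul (by positivity), Real.sqrt_mul_self (by positivity)]
    exact h x
  norm_triangle x y := by
    have hx : 0 ≤ ‖x‖ := Real.sqrt_nonneg _
    have hy : 0 ≤ ‖y‖ := Real.sqrt_nonneg _
    refine le_of_sq_le_sq ?_ (add_nonneg hx hy)
    have h0 : ‖x + y‖ ^ 2 ≤ ‖S.sinner x x‖ + ‖S.sinner x y‖ + ‖S.sinner y x‖
        + ‖S.sinner y y‖ := by
      rw [S.norm_sq]
      have : S.sinner (x + y) (x + y) = S.sinner x x + S.sinner x y + S.sinner y x
        + S.sinner y y := S.inner_add_self x y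
      rw [this]
      exact norm_add₄_le
    have h2 := S.norm_inner_le x y
    have h3 := S.norm_inner_le y x
    have h4 := S.norm_sq x
    have h5 := S.norm_sq y
    nlinarith

instance : SeminormedAddCommGroup S.Space := SeminormedAddCommGroup.ofCore S.core
instance : NormedSpace ℂ S.Space := ⟨fun c x => (S.core.norm_smul c x).le⟩

theorem continuous_sinner : Continuous fun p : S.Space × S.Space => S.sinner p.1 p.2 := by
  let B : S.Space →L⋆[ℂ] S.Space →L[ℂ] D := LinearMap.mkContinuous₂ S.sinner 1 (fun x y => by
    rw [one_mul]; exact S.norm_inner_le x y)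
  exact (B.continuous.comp continuous_fst).clm_apply continuous_snd

open UniformSpace in
/-- The continuous extension of the inner product to the completion. -/
def cinnerFun (p : Completion S.Space × Completion S.Space) : D :=
  ((Completion.isDenseInducing_toCompl S.Space).prodMap
    (Completion.isDenseInducing_toCompl S.Space)).extend
    (fun q : S.Space × S.Space => S.sinner q.1 q.2) p

open UniformSpace in
theorem cinnerFun_coe (x y : S.Space) :
    S.cinnerFun ((x : Completion S.Space), (y : Completion S.Space)) = S.sinner x y :=
  ((Completion.isDenseInducing_toCompl S.Space).prodMap
    (Completion.isDenseInducing_toCompl S.Space)).extend_eq S.continuous_sinner (x, y)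

open UniformSpace in
@[fun_prop]
theorem continuous_cinnerFun : Continuous S.cinnerFun := by
  let φ : S.Space →+ S.Space →+ D :=
    { toFun := fun x => (S.sinner x).toAddMonoidHom
      map_zero' := by ext y; simp
      map_add' := fun x y => by ext z; simp }
  have h : Continuous fun p : S.Space × S.Space => φ p.1 p.2 := S.continuous_sinner
  exact (Completion.isDenseInducing_toCompl S.Space).extend_Z_bilin
    (Completion.isDenseInducing_toCompl S.Space) h

open UniformSpace in
theorem continuous_cinnerFun_comp {T : Type*} [TopologicalSpace T]
    {f g : T → Completion S.Space} (hf : Continuous f) (hg : Continuous g) :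
    Continuous fun t => S.cinnerFun (f t, g t) :=
  S.continuous_cinnerFun.comp (hf.prodMk hg)

open UniformSpace in
theorem cinnerFun_star (x y : Completion S.Space) :
    star (S.cinnerFun (x, y)) = S.cinnerFun (y, x) :=
  Completion.induction_on₂ x y
    (isClosed_eq (S.continuous_cinnerFun_comp continuous_fst continuous_snd).star
      (S.continuous_cinnerFun_comp continuous_snd continuous_fst))
    fun a b => by rw [cinnerFun_coe, cinnerFun_coe]; exact S.star_inner a b

open UniformSpace in
theorem cinnerFun_add (x y z : Completion S.Space) :
    S.cinnerFun (x, y + z) = S.cinnerFun (x, y) + S.cinnerFun (x, z) := by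
  refine Completion.induction_on₃ x y z (isClosed_eq
    (S.continuous_cinnerFun_comp continuous_fst (by fun_prop)) (Continuous.add
      (S.continuous_cinnerFun_comp continuous_fst (by fun_prop))
      (S.continuous_cinnerFun_comp continuous_fst (by fun_prop)))) fun a b c => ?_
  rw [← Completion.coe_add, cinnerFun_coe, cinnerFun_coe, cinnerFun_coe, map_add]

open UniformSpace in
theorem cinnerFun_smul (c : ℂ) (x y : Completion S.Space) :
    S.cinnerFun (x, c • y) = c • S.cinnerFun (x, y) := by
  refine Completion.induction_on₂ x y (isClosed_eq
    (S.continuous_cinnerFun_comp continuous_fst (continuous_snd.const_smul c))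
    ((S.continuous_cinnerFun_comp continuous_fst continuous_snd).const_smul c)) fun a b => ?_
  rw [← Completion.coe_smul, cinnerFun_coe, cinnerFun_coe, map_smul]

open UniformSpace in
/-- The inner product on the completion. -/
def cinner : Completion S.Space →ₗ⋆[ℂ] Completion S.Space →ₗ[ℂ] D :=
  LinearMap.mk₂'ₛₗ (starRingEnd ℂ) (RingHom.id ℂ) (fun x y => S.cinnerFun (x, y))
    (fun x y z => by
      rw [← cinnerFun_star, cinnerFun_add, star_add, cinnerFun_star, cinnerFun_star])
    (fun c x y => by
      rw [← cinnerFun_star, cinnerFun_smul, star_smul, cinnerFun_star]; rfl)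
    S.cinnerFun_add
    (fun c x y => S.cinnerFun_smul c x y)

open UniformSpace in
theorem cinner_coe (x y : S.Space) :
    S.cinner (x : Completion S.Space) (y : Completion S.Space) = S.sinner x y :=
  S.cinnerFun_coe x y

open UniformSpace in
theorem continuous_cinner {T : Type*} [TopologicalSpace T] {f g : T → Completion S.Space}
    (hf : Continuous f) (hg : Continuous g) : Continuous fun t => S.cinner (f t) (g t) :=
  S.continuous_cinnerFun.comp (hf.prodMk hg)

open UniformSpace in
theorem cinner_norm_sq (x : Completion S.Space) : ‖x‖ ^ 2 = ‖S.cinner x x‖ :=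
  Completion.induction_on x
    (isClosed_eq (by fun_prop) (S.continuous_cinner continuous_id continuous_id).norm)
    fun a => by rw [cinner_coe, Completion.norm_coe, S.norm_sq]

open UniformSpace in
theorem cinner_star (x y : Completion S.Space) : star (S.cinner x y) = S.cinner y x :=
  S.cinnerFun_star x y

open UniformSpace in
theorem cinner_nonneg (x : Completion S.Space) : ∃ b : D, S.cinner x x = star b * b := by
  let _ : PartialOrder D := CStarAlgebra.spectralOrder D
  have _ : StarOrderedRing D := CStarAlgebra.spectralOrderedRing D
  rw [← CStarAlgebra.nonneg_iff_eq_star_mul_self]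
  refine Completion.induction_on x
    (CStarAlgebra.isClosed_nonneg.preimage (S.continuous_cinner continuous_id continuous_id))
    fun a => ?_
  rw [cinner_coe]
  exact CStarAlgebra.nonneg_iff_eq_star_mul_self.2 (S.inner_self_nonneg a)

open UniformSpace in
theorem cinner_definite (x : Completion S.Space) (h : S.cinner x x = 0) : x = 0 := by
  have := S.cinner_norm_sq x
  rw [h, norm_zero] at this
  exact norm_eq_zero.1 (pow_eq_zero_iff two_ne_zero |>.1 this)

open UniformSpace in
theorem cinner_ext {x y : Completion S.Space} (h : ∀ z, S.cinner z x = S.cinner z y) : x = y := by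
  refine sub_eq_zero.1 (S.cinner_definite _ ?_)
  rw [map_sub, h, sub_self]

theorem norm_sact_sub_le (x y : S.Space) (d : D) : ‖S.sact x d - S.sact y d‖ ≤ ‖d‖ * ‖x - y‖ := by
  have hr : ∀ z, S.sinner z (S.sact x d - S.sact y d) = S.sinner z (x - y) * d := fun z => by
    rw [map_sub, map_sub, sub_mul]
    exact congrArg₂ (· - ·) (S.inner_act z x d) (S.inner_act z y d)
  have hs : ∀ a b, star (S.sinner a b) = S.sinner b a := S.star_inner
  have h : ‖S.sact x d - S.sact y d‖ ^ 2 ≤ (‖d‖ * ‖x - y‖) ^ 2 := by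
    rw [S.norm_sq, hr, ← hs, hr, star_mul, hs]
    calc ‖star d * S.sinner (x - y) (x - y) * d‖
        ≤ ‖star d‖ * ‖S.sinner (x - y) (x - y)‖ * ‖d‖ :=
          (norm_mul_le _ _).trans (by gcongr; exact norm_mul_le _ _)
      _ = (‖d‖ * ‖x - y‖) ^ 2 := by rw [norm_star, ← S.norm_sq]; ring
  exact le_of_sq_le_sq h (by positivity)

open UniformSpace in
/-- The right action on the completion. -/
def cactFun (x : Completion S.Space) (d : D) : Completion S.Space :=
  Completion.map (fun x => S.sact x d) x

theorem uniformContinuous_sact (d : D) : UniformContinuous fun x : S.Space => S.sact x d :=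
  (LipschitzWith.of_dist_le_mul (K := ‖d‖₊) fun x y => by
    rw [dist_eq_norm, dist_eq_norm]; exact S.norm_sact_sub_le x y d).uniformContinuous

open UniformSpace in
theorem cinner_cactFun (x y : Completion S.Space) (d : D) :
    S.cinner x (S.cactFun y d) = S.cinner x y * d := by
  have hu := S.uniformContinuous_sact d
  refine Completion.induction_on₂ x y (isClosed_eq
    (S.continuous_cinner continuous_fst (Completion.continuous_map.comp continuous_snd))
    ((S.continuous_cinner continuous_fst continuous_snd).mul continuous_const)) fun a b => ?_
  rw [cactFun, Completion.map_coe hu, cinner_coe, cinner_coe]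
  exact S.inner_act a b d

open UniformSpace in
/-- The Hausdorff completion of a pre-Hilbert module is a Hilbert module. -/
def completion : HilbertModule D where
  carrier := Completion S.Space
  act := LinearMap.mk₂ ℂ S.cactFun
    (fun x y d => S.cinner_ext fun z => by simp only [cinner_cactFun, map_add, add_mul])
    (fun c x d => S.cinner_ext fun z => by simp only [cinner_cactFun, map_smul, smul_mul_assoc])
    (fun x d e => S.cinner_ext fun z => by simp only [cinner_cactFun, map_add, mul_add])
    (fun c x d => S.cinner_ext fun z => by simp only [cinner_cactFun, map_smul, mul_smul_comm])
  inner := S.cinner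
  act_mul x d e := S.cinner_ext fun z => by
    simp only [LinearMap.mk₂_apply, cinner_cactFun, mul_assoc]
  inner_act x y d := S.cinner_cactFun x y d
  star_inner := S.cinner_star
  inner_self_nonneg := S.cinner_nonneg
  inner_self_eq_zero := S.cinner_definite
  norm_sq := S.cinner_norm_sq

open UniformSpace in
/-- The canonical map of a pre-Hilbert module into its Hausdorff completion. -/
def toCompletion : X →ₗ[ℂ] S.completion :=
  (Completion.toComplₗᵢ (𝕜 := ℂ) (E := S.Space)).toLinearMap

open UniformSpace in
theorem inner_toCompletion (x y : X) :
    S.completion.inner (S.toCompletion x) (S.toCompletion y) = S.inner x y :=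
  S.cinner_coe x y

open UniformSpace in
theorem denseRange_toCompletion : DenseRange S.toCompletion :=
  Completion.denseRange_coe (α := S.Space)

end PreHilbertModule

namespace HilbertModule

variable {D : Type u} [NonUnitalCStarAlgebra D] (E : HilbertModule D)

theorem inner_act_left (x y : E) (d : D) : E.inner (E.act x d) y = star d * E.inner x y := by
  rw [← E.star_inner, E.inner_act, star_mul, E.star_inner]

theorem inner_sum_act_self {n : ℕ} (ξ : Fin n → E) (N : Fin n → D) :
    E.inner (∑ i, E.act (ξ i) (N i)) (∑ j, E.act (ξ j) (N j)) =
      ∑ i, ∑ j, star (N i) * E.inner (ξ i) (ξ j) * N j := by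
  simp only [map_sum, LinearMap.sum_apply, E.inner_act, E.inner_act_left]
  rw [Finset.sum_comm]

/-- A criterion for positivity in a C⋆-algebra. -/
theorem exists_eq_star_mul_self {B : Type*} [NonUnitalCStarAlgebra B] {M : B}
    (hM : IsSelfAdjoint M)
    (h : ∀ N C : B, star N * M * N = -(star C * C) → C = 0) :
    ∃ C, M = star C * C := by
  let _ : PartialOrder B := CStarAlgebra.spectralOrder B
  have _ : StarOrderedRing B := CStarAlgebra.spectralOrderedRing B
  rw [← CStarAlgebra.nonneg_iff_eq_star_mul_self]
  set N := M⁻ with hN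
  have hN0 : 0 ≤ N := CFC.negPart_nonneg M
  have hNs : star N = N := hN0.isSelfAdjoint
  obtain ⟨C, hC⟩ := CStarAlgebra.nonneg_iff_eq_star_mul_self.1 (star_left_conjugate_nonneg hN0 N)
  have hNMN : star N * M * N = -(star C * C) := by
    have h1 : N * M = -(N * N) := by
      conv_lhs => rw [← CFC.posPart_sub_negPart M hM]
      rw [mul_sub, hN, CFC.negPart_mul_posPart, zero_sub]
    rw [← hC, hNs, h1, neg_mul]
  rw [h N C hNMN, mul_zero] at hC
  have hNN : star N * N = 0 := by
    refine (CStarRing.star_mul_self_eq_zero_iff _).1 ?_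
    rw [hNs] at hC ⊢
    rw [star_mul, hNs, ← mul_assoc, hC, zero_mul]
  exact (CFC.negPart_eq_zero_iff M hM).1 ((CStarRing.star_mul_self_eq_zero_iff _).1 hNN)

/-- The Gram matrix of finitely many elements of a Hilbert module is positive. -/
theorem gram_eq {n : ℕ} (ξ : Fin n → E) :
    ∃ C : Fin n → Fin n → D, ∀ i j, E.inner (ξ i) (ξ j) = ∑ k, star (C k i) * C k j := by
  let _ : PartialOrder D := CStarAlgebra.spectralOrder D
  have _ : StarOrderedRing D := CStarAlgebra.spectralOrderedRing D
  let M : CStarMatrix (Fin n) (Fin n) D := CStarMatrix.ofMatrix fun i j => E.inner (ξ i) (ξ j)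
  have hM : IsSelfAdjoint M := by
    ext i j
    exact E.star_inner _ _
  suffices h : ∃ C, M = star C * C by
    obtain ⟨C, hC⟩ := h
    refine ⟨fun i j => C i j, fun i j => ?_⟩
    have := congrFun (congrFun hC i) j
    rw [CStarMatrix.mul_apply] at this
    exact this
  refine exists_eq_star_mul_self (B := CStarMatrix (Fin n) (Fin n) D) hM fun N C hNC => ?_
  have hsum : ∀ k, ∑ i, star (C i k) * C i k = 0 := by
    intro k
    refine le_antisymm ?_ (Finset.sum_nonneg fun i _ => star_mul_self_nonneg (C i k))
    have h1 : (star N * M * N) k k = E.inner (∑ i, E.act (ξ i) (N i k))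
        (∑ j, E.act (ξ j) (N j k)) := by
      rw [E.inner_sum_act_self, CStarMatrix.mul_apply, Finset.sum_comm]
      refine Finset.sum_congr rfl fun j _ => ?_
      rw [CStarMatrix.mul_apply, Finset.sum_mul]
      rfl
    have h2 : 0 ≤ (star N * M * N) k k := by
      rw [h1]
      exact CStarAlgebra.nonneg_iff_eq_star_mul_self.2 (E.inner_self_nonneg _)
    rw [hNC] at h2
    have h3 : (-(star C * C)) k k = -∑ i, star (C i k) * C i k := by
      have : (star C * C) k k = ∑ i, star (C i k) * C i k := by
        rw [CStarMatrix.mul_apply]; rfl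
      rw [← this]; rfl
    rw [h3] at h2
    exact neg_nonneg.1 h2
  ext i k
  have h2 := (Finset.sum_eq_zero_iff_of_nonneg
    (fun i _ => star_mul_self_nonneg (C i k))).1 (hsum k) i (Finset.mem_univ i)
  exact (CStarRing.star_mul_self_eq_zero_iff _).1 h2

end HilbertModule

/-- A C⋆-correspondence from `D₁` to `D₂` with underlying Hilbert `D₂`-module `F`: a nondegenerate
representation of `D₁` on `F` by adjointable operators. -/
structure Correspondence (D₁ : Type u) [NonUnitalCStarAlgebra D₁] {D₂ : Type u}
    [NonUnitalCStarAlgebra D₂] (F : HilbertModule D₂) where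
  left : D₁ →ₙₐ[ℂ] (F →L[ℂ] F)
  inner_left : ∀ d x y, F.inner (left d x) y = F.inner x (left (star d) y)
  nondegenerate : Dense (Submodule.span ℂ {y | ∃ d x, left d x = y} : Set F)

section Tensor

variable {D₁ D₂ : Type u} [NonUnitalCStarAlgebra D₁] [NonUnitalCStarAlgebra D₂]
  (E : HilbertModule D₁) {F : HilbertModule D₂} (G : Correspondence D₁ F)

/-- The sesquilinear form `⟨ξ₁ ⊗ η₁, ξ₂ ⊗ η₂⟩ = ⟨η₁, ⟨ξ₁, ξ₂⟩ · η₂⟩` on the algebraic tensor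
product. -/
def tensorForm : (E ⊗[ℂ] F) →ₗ⋆[ℂ] (E ⊗[ℂ] F) →ₗ[ℂ] D₂ :=
  TensorProduct.lift (LinearMap.mk₂'ₛₗ (starRingEnd ℂ) (starRingEnd ℂ)
    (fun ξ₁ η₁ => TensorProduct.lift (LinearMap.mk₂ ℂ
      (fun ξ₂ η₂ => F.inner η₁ (G.left (E.inner ξ₁ ξ₂) η₂))
      (fun x y z => by simp) (fun c x y => by simp) (fun x y z => by simp)
      (fun c x y => by simp)))
    (fun x y z => by ext; simp) (fun c x y => by ext; simp) (fun x y z => by ext; simp)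
    (fun c x y => by ext; simp))

theorem tensorForm_tmul (ξ₁ ξ₂ : E) (η₁ η₂ : F) :
    tensorForm E G (ξ₁ ⊗ₜ η₁) (ξ₂ ⊗ₜ η₂) = F.inner η₁ (G.left (E.inner ξ₁ ξ₂) η₂) := rfl

/-- The algebraic tensor product as a pre-Hilbert module. -/
def tensorPre : PreHilbertModule D₂ (E ⊗[ℂ] F) where
  act t d := (F.act.flip d).lTensor E t
  inner := tensorForm E G
  inner_act s t d := by
    induction s with
    | zero => simp
    | add s s' hs hs' => simp only [map_add, LinearMap.add_apply, hs, hs', add_mul]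
    | tmul ξ η =>
      induction t with
      | zero => simp
      | add s s' hs hs' => simp only [map_add, hs, hs', add_mul]
      | tmul ξ' η' =>
        rw [LinearMap.lTensor_tmul, tensorForm_tmul, tensorForm_tmul, LinearMap.flip_apply,
          ← star_star (E.inner ξ ξ'), ← G.inner_left, ← G.inner_left, F.inner_act]
  star_inner s t := by
    induction s with
    | zero => simp
    | add s s' hs hs' => simp only [map_add, LinearMap.add_apply, star_add, hs, hs']
    | tmul ξ η =>
      induction t with
      | zero => simp
      | add s s' hs hs' => simp only [map_add, LinearMap.add_apply, star_add, hs, hs']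
      | tmul ξ' η' =>
        rw [tensorForm_tmul, tensorForm_tmul, F.star_inner, G.inner_left, E.star_inner]
  inner_self_nonneg t := by
    let _ : PartialOrder D₂ := CStarAlgebra.spectralOrder D₂
    have _ : StarOrderedRing D₂ := CStarAlgebra.spectralOrderedRing D₂
    rw [← CStarAlgebra.nonneg_iff_eq_star_mul_self]
    obtain ⟨n, ξ, η, rfl⟩ := TensorProduct.exists_sum_tmul_eq t
    obtain ⟨C, hC⟩ := E.gram_eq ξ
    have h : tensorForm E G (∑ j, ξ j ⊗ₜ[ℂ] η j) (∑ j, ξ j ⊗ₜ[ℂ] η j) =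
        ∑ k, F.inner (∑ i, G.left (C k i) (η i)) (∑ j, G.left (C k j) (η j)) := by
      have h1 : ∀ i j, tensorForm E G (ξ i ⊗ₜ[ℂ] η i) (ξ j ⊗ₜ[ℂ] η j) =
          ∑ k, F.inner (G.left (C k i) (η i)) (G.left (C k j) (η j)) := fun i j => by
        rw [tensorForm_tmul, hC, map_sum, sum_apply, map_sum]
        refine Finset.sum_congr rfl fun k _ => ?_
        rw [G.inner_left, map_mul]
        rfl
      simp only [map_sum, LinearMap.sum_apply, h1]
      rw [Finset.sum_congr rfl fun j _ => Finset.sum_comm, Finset.sum_comm]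
    rw [h]
    exact Finset.sum_nonneg fun k _ =>
      CStarAlgebra.nonneg_iff_eq_star_mul_self.2 (F.inner_self_nonneg _)

/-- The interior tensor product `E ⊗_{D₁} F`: the Hausdorff completion of the algebraic tensor
product for the inner product `⟨ξ₁ ⊗ η₁, ξ₂ ⊗ η₂⟩ = ⟨η₁, ⟨ξ₁, ξ₂⟩ · η₂⟩`. -/
def interiorTensor : HilbertModule D₂ := (tensorPre E G).completion

/-- The canonical map of the algebraic into the interior tensor product. -/
def toInterior : (E ⊗[ℂ] F) →ₗ[ℂ] interiorTensor E G := (tensorPre E G).toCompletion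

end Tensor

namespace HilbertModule

variable {D : Type u} [NonUnitalCStarAlgebra D] (E : HilbertModule D)

/-- A Hilbert module as a pre-Hilbert module. -/
def toPre : PreHilbertModule D E where
  act x d := E.act x d
  inner := E.inner
  inner_act := E.inner_act
  star_inner := E.star_inner
  inner_self_nonneg := E.inner_self_nonneg

theorem norm_inner_le (x y : E) : ‖E.inner x y‖ ≤ ‖x‖ * ‖y‖ := by
  refine le_of_sq_le_sq ?_ (by positivity)
  rw [mul_pow, E.norm_sq, E.norm_sq]
  exact E.toPre.cauchySchwarz x y

theorem continuous_inner {T : Type*} [TopologicalSpace T] {f g : T → E}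
    (hf : Continuous f) (hg : Continuous g) : Continuous fun t => E.inner (f t) (g t) := by
  let B : E →L⋆[ℂ] E →L[ℂ] D := LinearMap.mkContinuous₂ E.inner 1 (fun x y => by
    rw [one_mul]; exact E.norm_inner_le x y)
  exact (B.continuous.comp hf).clm_apply hg

theorem continuous_act (d : D) : Continuous fun x : E => E.act x d := by
  have h : ∀ x, ‖E.act x d‖ ≤ ‖d‖ * ‖x‖ := fun x => by
    refine le_of_sq_le_sq ?_ (by positivity)
    rw [E.norm_sq, E.inner_act, E.inner_act_left, mul_pow, E.norm_sq]
    calc ‖star d * E.inner x x * d‖ ≤ ‖star d‖ * ‖E.inner x x‖ * ‖d‖ :=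
          (norm_mul_le _ _).trans (by gcongr; exact norm_mul_le _ _)
      _ = ‖d‖ ^ 2 * ‖E.inner x x‖ := by rw [norm_star]; ring
  exact (LinearMap.mkContinuous (E.act.flip d) ‖d‖ h).continuous

end HilbertModule

section Rep

variable (A : Type v) [Ring A] [StarRing A] [Algebra ℂ A]
  {D : Type u} [NonUnitalCStarAlgebra D] (E : HilbertModule D)

/-- A representation of the unital ⋆-algebra `A` on the Hilbert `D`-module `E`, by operators that
are defined on a common dense `D`-submodule `dom` of `E`. -/
structure Representation where
  dom : Submodule ℂ E
  dense : Dense (dom : Set E)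
  act_mem : ∀ x ∈ dom, ∀ d, E.act x d ∈ dom
  op : A →ₐ[ℂ] Module.End ℂ dom
  op_act : ∀ (a : A) (x : dom) (d : D), (op a ⟨E.act x d, act_mem x x.2 d⟩ : E) = E.act (op a x) d
  symm : ∀ (a : A) (x y : dom), E.inner (op a x) y = E.inner x (op (star a) y)

variable {A E}

/-- The uniform structure of the graph topology on the domain, that is, the one generated by the
graph norms `ξ ↦ ‖(ξ, π(a)ξ)‖` for `a ∈ A`. -/
abbrev Representation.graphUniformity (π : Representation A E) : UniformSpace π.dom :=
  ⨅ a : A, UniformSpace.comap (fun x : π.dom => ((x : E), (π.op a x : E))) inferInstance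

variable (A E)

/-- A closed representation: the domain is complete in the graph topology. -/
structure ClosedRep extends Representation A E where
  closed : @CompleteSpace dom toRepresentation.graphUniformity

/-- The data of a representation of `A` on `E` with domain the image of `j : Y → E`, with
`π(a) (j y) = j (ρ(a) y)`. The map `j` need not be injective; that `π(a)` is well defined follows
from `inner_j`. -/
structure Core (Y : Type u) [AddCommGroup Y] [Module ℂ Y] where
  ρ : A →ₐ[ℂ] Module.End ℂ Y
  j : Y →ₗ[ℂ] E
  act : Y → D → Y
  dense : DenseRange j
  j_act : ∀ a y d, j (ρ a (act y d)) = E.act (j (ρ a y)) d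
  inner_j : ∀ a y z, E.inner (j (ρ a y)) (j z) = E.inner (j y) (j (ρ (star a) z))

namespace Core

variable {A E} {Y : Type u} [AddCommGroup Y] [Module ℂ Y] (K : Core A E Y)

/-- `y ↦ (π(a) (j y))_{a ∈ A}` -/
def graph : Y →ₗ[ℂ] (A → E) := LinearMap.pi fun a => K.j ∘ₗ K.ρ a

/-- The closure of the set of all `(π(a) ξ)_{a ∈ A}` in the product topology. This is the
completion of the domain in the graph topology. -/
def closureGraph : Submodule ℂ (A → E) := (LinearMap.range K.graph).topologicalClosure

theorem isClosed_closureGraph : IsClosed (K.closureGraph : Set (A → E)) :=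
  Submodule.isClosed_topologicalClosure _

theorem graph_mem (y : Y) : K.graph y ∈ K.closureGraph :=
  Submodule.le_topologicalClosure _ ⟨y, rfl⟩

theorem closure_induction {p : (A → E) → Prop} (hp : IsClosed {g | p g})
    (h : ∀ y, p (K.graph y)) {g : A → E} (hg : g ∈ K.closureGraph) : p g := by
  have : closure (Set.range K.graph) ⊆ {g | p g} :=
    closure_minimal (by rintro _ ⟨y, rfl⟩; exact h y) hp
  refine this ?_
  rw [← LinearMap.coe_range]
  exact hg

theorem map_add_of_mem {g : A → E} (hg : g ∈ K.closureGraph) (a b : A) :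
    g (a + b) = g a + g b := by
  refine K.closure_induction (p := fun g => g (a + b) = g a + g b)
    (isClosed_eq (by fun_prop) (by fun_prop)) (fun y => ?_) hg
  simp [graph]

theorem map_smul_of_mem {g : A → E} (hg : g ∈ K.closureGraph) (c : ℂ) (a : A) :
    g (c • a) = c • g a := by
  refine K.closure_induction (p := fun g => g (c • a) = c • g a)
    (isClosed_eq (by fun_prop) (by fun_prop)) (fun y => ?_) hg
  simp [graph]

theorem shift_mem {g : A → E} (hg : g ∈ K.closureGraph) (b : A) :
    (fun a => g (a * b)) ∈ K.closureGraph := by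
  refine K.closure_induction (p := fun g => (fun a => g (a * b)) ∈ K.closureGraph)
    (K.isClosed_closureGraph.preimage (by fun_prop)) (fun y => ?_) hg
  have : (fun a => K.graph y (a * b)) = K.graph (K.ρ b y) := by
    ext a; simp [graph]
  rw [this]
  exact K.graph_mem _

theorem act_mem {g : A → E} (hg : g ∈ K.closureGraph) (d : D) :
    (fun a => E.act (g a) d) ∈ K.closureGraph := by
  refine K.closure_induction (p := fun g => (fun a => E.act (g a) d) ∈ K.closureGraph)
    (K.isClosed_closureGraph.preimage (continuous_pi fun a =>
      (E.continuous_act d).comp (continuous_apply a))) (fun y => ?_) hg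
  have : (fun a => E.act (K.graph y a) d) = K.graph (K.act y d) := by
    ext a; exact (K.j_act a y d).symm
  rw [this]
  exact K.graph_mem _

theorem inner_of_mem {g h : A → E} (hg : g ∈ K.closureGraph) (hh : h ∈ K.closureGraph) (a : A) :
    E.inner (g a) (h 1) = E.inner (g 1) (h (star a)) := by
  refine K.closure_induction (p := fun g => E.inner (g a) (h 1) = E.inner (g 1) (h (star a)))
    (isClosed_eq (E.continuous_inner (by fun_prop) (by fun_prop))
      (E.continuous_inner (by fun_prop) (by fun_prop))) (fun y => ?_) hg
  refine K.closure_induction (p := fun h => E.inner (K.graph y a) (h 1) =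
      E.inner (K.graph y 1) (h (star a)))
    (isClosed_eq (E.continuous_inner (by fun_prop) (by fun_prop))
      (E.continuous_inner (by fun_prop) (by fun_prop))) (fun z => ?_) hh
  simpa [graph] using K.inner_j a y z

/-- Evaluation at `1`. -/
def evalOne : K.closureGraph →ₗ[ℂ] E := LinearMap.proj 1 ∘ₗ K.closureGraph.subtype

theorem evalOne_injective : Function.Injective K.evalOne := by
  rw [injective_iff_map_eq_zero]
  rintro ⟨g, hg⟩ h
  have h0 : g 1 = 0 := h
  ext a
  refine E.inner_self_eq_zero _ ?_
  have := K.inner_of_mem hg (K.shift_mem hg a) a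
  simpa [h0] using this

/-- The closure of the domain in the graph topology is identified with a subspace of `E`. -/
def equiv : K.closureGraph ≃ₗ[ℂ] LinearMap.range K.evalOne :=
  LinearEquiv.ofInjective K.evalOne K.evalOne_injective

/-- The action of `A` on the completion of the domain in the graph topology. -/
def shift : A →ₐ[ℂ] Module.End ℂ K.closureGraph :=
  AlgHom.ofLinearMap
    { toFun := fun b =>
        { toFun := fun g => ⟨fun a => g.1 (a * b), K.shift_mem g.2 b⟩
          map_add' := fun _ _ => rfl
          map_smul' := fun _ _ => rfl }
      map_add' := fun b c => by
        ext g a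
        change g.1 (a * (b + c)) = g.1 (a * b) + g.1 (a * c)
        rw [mul_add, K.map_add_of_mem g.2]
      map_smul' := fun c b => by
        ext g a
        change g.1 (a * (c • b)) = c • g.1 (a * b)
        rw [mul_smul_comm, K.map_smul_of_mem g.2] }
    (by
      ext g a
      change g.1 (a * 1) = g.1 a
      rw [mul_one])
    (fun b c => by
      ext g a
      change g.1 (a * (b * c)) = g.1 (a * b * c)
      rw [mul_assoc])

theorem conj_shift_apply (a : A) (g : K.closureGraph) :
    ((K.equiv.conjAlgEquiv ℂ (K.shift a) (K.equiv g)) : E) = g.1 a := by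
  have h : K.equiv.conjAlgEquiv ℂ (K.shift a) (K.equiv g) = K.equiv (K.shift a g) := by
    simp [LinearEquiv.conjAlgEquiv]
  rw [h]
  change g.1 (1 * a) = g.1 a
  rw [one_mul]

/-- The (not yet known to be closed) closure. -/
def closureRep : Representation A E where
  dom := LinearMap.range K.evalOne
  dense := by
    refine K.dense.mono ?_
    rintro _ ⟨y, rfl⟩
    refine ⟨⟨K.graph y, K.graph_mem y⟩, ?_⟩
    change K.j (K.ρ 1 y) = K.j y
    simp
  act_mem := by
    rintro _ ⟨g, rfl⟩ d
    exact ⟨⟨_, K.act_mem g.2 d⟩, rfl⟩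
  op := (K.equiv.conjAlgEquiv ℂ).toAlgHom.comp K.shift
  op_act a x d := by
    obtain ⟨g, rfl⟩ := K.equiv.surjective x
    have h1 := K.conj_shift_apply a ⟨_, K.act_mem g.2 d⟩
    have h2 := K.conj_shift_apply a g
    change _ = E.act (g.1 a) d at h1
    change _ = E.act ((K.equiv.conjAlgEquiv ℂ (K.shift a) (K.equiv g)) : E) d
    rw [h2]
    exact h1
  symm a x y := by
    obtain ⟨g, rfl⟩ := K.equiv.surjective x
    obtain ⟨h, rfl⟩ := K.equiv.surjective y
    have h1 := K.conj_shift_apply a g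
    have h2 := K.conj_shift_apply (star a) h
    change E.inner ((K.equiv.conjAlgEquiv ℂ (K.shift a) (K.equiv g)) : E) (h.1 1) =
      E.inner (g.1 1) ((K.equiv.conjAlgEquiv ℂ (K.shift (star a)) (K.equiv h)) : E)
    rw [h1, h2]
    exact K.inner_of_mem g.2 h.2 a

theorem closureRep_op_apply (a : A) (g : K.closureGraph) :
    (K.closureRep.op a (K.equiv g) : E) = g.1 a :=
  K.conj_shift_apply a g

/-- The closure of the representation given by `K`: the closed representation that has the image
of `j` as a core, on which `a ∈ A` acts by `j y ↦ j (ρ(a) y)`. -/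
def closure : ClosedRep A E where
  toRepresentation := K.closureRep
  closed := by
    let _ : UniformSpace K.closureRep.dom := K.closureRep.graphUniformity
    let f : K.closureRep.dom → A → E := fun x a => K.closureRep.op a x
    have hf : IsUniformInducing f := by
      rw [isUniformInducing_iff_uniformSpace, Pi.uniformSpace_eq, UniformSpace.comap_iInf]
      simp only [← UniformSpace.comap_comap]
      have h1 : ∀ x : K.closureRep.dom, ((K.closureRep.op 1 x : K.closureRep.dom) : E) = x :=
        fun x => by rw [map_one]; rfl
      refine le_antisymm (le_iInf fun a => ?_) (le_iInf fun a => ?_)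
      · change _ ≤ UniformSpace.comap _ (UniformSpace.comap Prod.fst _ ⊓
          UniformSpace.comap Prod.snd _)
        rw [UniformSpace.comap_inf, ← UniformSpace.comap_comap, ← UniformSpace.comap_comap]
        refine le_inf ((iInf_le _ 1).trans (le_of_eq ?_)) (iInf_le _ a)
        congr 1
        exact funext h1
      · refine (iInf_le _ a).trans ?_
        change UniformSpace.comap _ (UniformSpace.comap Prod.fst _ ⊓
          UniformSpace.comap Prod.snd _) ≤ _
        rw [UniformSpace.comap_inf, ← UniformSpace.comap_comap, ← UniformSpace.comap_comap]
        exact inf_le_right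
    rw [completeSpace_iff_isComplete_range hf]
    have hr : Set.range f = K.closureGraph := by
      ext g
      constructor
      · rintro ⟨x, rfl⟩
        obtain ⟨g, rfl⟩ := K.equiv.surjective x
        have : f (K.equiv g) = g.1 := funext fun a => K.closureRep_op_apply a g
        rw [this]
        exact g.2
      · intro hg
        exact ⟨K.equiv ⟨g, hg⟩, funext fun a => K.closureRep_op_apply a ⟨g, hg⟩⟩
    rw [hr]
    exact K.isClosed_closureGraph.isComplete

theorem j_mem_dom (y : Y) : K.j y ∈ K.closure.dom :=
  ⟨⟨K.graph y, K.graph_mem y⟩, by change K.j (K.ρ 1 y) = K.j y; simp⟩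

theorem closure_op_j (a : A) (y : Y) :
    (K.closure.op a ⟨K.j y, K.j_mem_dom y⟩ : E) = K.j (K.ρ a y) := by
  have h : (⟨K.j y, K.j_mem_dom y⟩ : K.closure.dom) = K.equiv ⟨K.graph y, K.graph_mem y⟩ := by
    ext
    change K.j y = K.j (K.ρ 1 y)
    simp
  rw [h]
  exact K.closureRep_op_apply a ⟨K.graph y, K.graph_mem y⟩

end Core

end Rep

/-! ### Interior tensor products and direct sums of representations -/

namespace PreHilbertModule

variable {D : Type u} [NonUnitalCStarAlgebra D] {X : Type u} [AddCommGroup X] [Module ℂ X]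
  (S : PreHilbertModule D X)

open UniformSpace in
theorem act_toCompletion (x : X) (d : D) :
    S.completion.act (S.toCompletion x) d = S.toCompletion (S.act x d) :=
  Completion.map_coe (S.uniformContinuous_sact d) x

theorem norm_toCompletion_sq (x : X) : ‖S.toCompletion x‖ ^ 2 = ‖S.inner x x‖ := by
  rw [S.completion.norm_sq, S.inner_toCompletion]

end PreHilbertModule

section Tensor

variable {D₁ D₂ : Type u} [NonUnitalCStarAlgebra D₁] [NonUnitalCStarAlgebra D₂]
  {E : HilbertModule D₁} {F : HilbertModule D₂} (G : Correspondence D₁ F)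

theorem Correspondence.bound (η : F) :
    ∃ C : ℝ, 0 ≤ C ∧ ∀ d, ‖F.inner η (G.left d η)‖ ≤ C * ‖d‖ := by
  let _ : PartialOrder D₁ := CStarAlgebra.spectralOrder D₁
  have _ : StarOrderedRing D₁ := CStarAlgebra.spectralOrderedRing D₁
  let _ : PartialOrder D₂ := CStarAlgebra.spectralOrder D₂
  have _ : StarOrderedRing D₂ := CStarAlgebra.spectralOrderedRing D₂
  let f : D₁ →ₗ[ℂ] D₂ :=
    { toFun := fun d => F.inner η (G.left d η)
      map_add' := fun x y => by simp
      map_smul' := fun c x => by simp }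
  let p : D₁ →ₚ[ℂ] D₂ := PositiveLinearMap.mk₀ f fun a ha => by
    obtain ⟨b, rfl⟩ := CStarAlgebra.nonneg_iff_eq_star_mul_self.1 ha
    have : f (star b * b) = F.inner (G.left b η) (G.left b η) := by
      rw [G.inner_left]
      change F.inner η (G.left (star b * b) η) = _
      rw [map_mul]
      rfl
    rw [this]
    exact CStarAlgebra.nonneg_iff_eq_star_mul_self.2 (F.inner_self_nonneg _)
  obtain ⟨C, hC⟩ := p.exists_norm_apply_le
  exact ⟨C, C.2, hC⟩

theorem continuous_toInterior_tmul (η : F) :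
    Continuous fun ξ : E => toInterior E G (ξ ⊗ₜ η) := by
  obtain ⟨C, hC0, hC⟩ := G.bound η
  let f : E →ₗ[ℂ] interiorTensor E G := toInterior E G ∘ₗ (TensorProduct.mk ℂ E F).flip η
  have h : ∀ ξ, ‖f ξ‖ ≤ √C * ‖ξ‖ := fun ξ => by
    refine le_of_sq_le_sq ?_ (by positivity)
    rw [mul_pow, Real.sq_sqrt hC0, E.norm_sq]
    refine le_trans (le_of_eq ((tensorPre E G).norm_toCompletion_sq (ξ ⊗ₜ η))) ?_
    exact hC (E.inner ξ ξ)
  exact (LinearMap.mkContinuous f _ h).continuous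

variable {A : Type v} [Ring A] [StarRing A] [Algebra ℂ A]

/-- The representation `a ↦ π(a) ⊗ 1` on the image of the algebraic tensor product of the domain
of `π` with `F` in the interior tensor product. -/
def ClosedRep.tensorCore (π : ClosedRep A E) : Core A (interiorTensor E G) (π.dom ⊗[ℂ] F) where
  ρ := (Module.End.rTensorAlgHom ℂ π.dom F).comp π.op
  j := toInterior E G ∘ₗ π.dom.subtype.rTensor F
  act t d := (F.act.flip d).lTensor π.dom t
  dense := by
    have hle : LinearMap.range (toInterior E G) ≤
        (LinearMap.range (toInterior E G ∘ₗ π.dom.subtype.rTensor F)).topologicalClosure := by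
      rintro _ ⟨t, rfl⟩
      induction t with
      | zero => rw [map_zero]; exact Submodule.zero_mem _
      | add s t hs ht => rw [map_add]; exact Submodule.add_mem _ hs ht
      | tmul ξ η =>
        have hcl : IsClosed {ξ : E | toInterior E G (ξ ⊗ₜ η) ∈
            (LinearMap.range (toInterior E G ∘ₗ π.dom.subtype.rTensor F)).topologicalClosure} :=
          (Submodule.isClosed_topologicalClosure _).preimage (continuous_toInterior_tmul G η)
        refine closure_minimal (s := (π.dom : Set E)) ?_ hcl (π.dense ξ)
        intro x hx
        exact Submodule.le_topologicalClosure _ ⟨(⟨x, hx⟩ : π.dom) ⊗ₜ η, rfl⟩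
    refine dense_closure.1 ?_
    refine ((tensorPre E G).denseRange_toCompletion).mono ?_
    rintro _ ⟨t, rfl⟩
    have := hle ⟨t, rfl⟩
    rwa [← SetLike.mem_coe, Submodule.topologicalClosure_coe, LinearMap.coe_range] at this
  j_act a t d := by
    refine Eq.trans ?_ ((tensorPre E G).act_toCompletion _ d).symm
    refine congrArg (toInterior E G) ?_
    change π.dom.subtype.rTensor F _ = (F.act.flip d).lTensor E (π.dom.subtype.rTensor F _)
    induction t with
    | zero => simp
    | add s t hs ht => simp only [map_add, hs, ht]
    | tmul ξ η => rfl
  inner_j a s t := by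
    refine ((tensorPre E G).inner_toCompletion _ _).trans
      (Eq.trans ?_ ((tensorPre E G).inner_toCompletion _ _).symm)
    change tensorForm E G _ _ = tensorForm E G _ _
    induction s with
    | zero => simp
    | add s s' hs hs' => simp only [map_add, LinearMap.add_apply, hs, hs']
    | tmul ξ η =>
      induction t with
      | zero => simp
      | add t t' ht ht' => simp only [map_add, ht, ht']
      | tmul ξ' η' =>
        exact congrArg (fun d => F.inner η (G.left d η')) (π.symm a ξ ξ')

/-- The closed representation `π ⊗_{D₁} 1` on the interior tensor product `E ⊗_{D₁} F`. -/
def ClosedRep.tensor (π : ClosedRep A E) : ClosedRep A (interiorTensor E G) :=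
  (π.tensorCore G).closure

end Tensor

section DirectSum

variable {D : Type u} [NonUnitalCStarAlgebra D] {ι : Type u} (E : ι → HilbertModule D)

theorem finite_support_inner (x y : Π₀ i, E i) :
    (Function.support fun i => (E i).inner (x i) (y i)).Finite :=
  (DFinsupp.finite_support y).subset fun i hi h => hi (by simp [h])

/-- The algebraic direct sum as a pre-Hilbert module, with `⟨x, y⟩ = ∑ᵢ ⟨xᵢ, yᵢ⟩`. -/
def directSumPre : PreHilbertModule D (Π₀ i, E i) where
  act x d := DFinsupp.mapRange.linearMap (fun i => (E i).act.flip d) x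
  inner := LinearMap.mk₂'ₛₗ (starRingEnd ℂ) (RingHom.id ℂ)
    (fun x y => ∑ᶠ i, (E i).inner (x i) (y i))
    (fun x y z => by
      rw [← finsum_add_distrib (finite_support_inner E x z) (finite_support_inner E y z)]
      simp)
    (fun c x y => by
      rw [smul_finsum' _ (finite_support_inner E x y)]
      simp)
    (fun x y z => by
      rw [← finsum_add_distrib (finite_support_inner E x y) (finite_support_inner E x z)]
      simp)
    (fun c x y => by
      rw [smul_finsum' _ (finite_support_inner E x y)]
      simp)
  inner_act x y d := by
    simp only [LinearMap.mk₂'ₛₗ_apply]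
    rw [finsum_mul' _ _ (finite_support_inner E x y)]
    refine finsum_congr fun i => ?_
    exact (E i).inner_act _ _ _
  star_inner x y := by
    simp only [LinearMap.mk₂'ₛₗ_apply]
    have := (starAddEquiv : D ≃+ D).toAddMonoidHom.map_finsum (finite_support_inner E x y)
    refine this.trans (finsum_congr fun i => ?_)
    exact (E i).star_inner _ _
  inner_self_nonneg x := by
    let _ : PartialOrder D := CStarAlgebra.spectralOrder D
    have _ : StarOrderedRing D := CStarAlgebra.spectralOrderedRing D
    rw [← CStarAlgebra.nonneg_iff_eq_star_mul_self]
    exact finsum_nonneg fun i =>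
      CStarAlgebra.nonneg_iff_eq_star_mul_self.2 ((E i).inner_self_nonneg _)

/-- The Hilbert module direct sum `⨁ᵢ Eᵢ`. -/
def directSumModule : HilbertModule D := (directSumPre E).completion

/-- The canonical map of the algebraic direct sum into the Hilbert module direct sum. -/
def toDirectSum : (Π₀ i, E i) →ₗ[ℂ] directSumModule E := (directSumPre E).toCompletion

open Classical in
/-- The inclusion of a direct summand. -/
def inclusion (i : ι) : E i →ₗ[ℂ] directSumModule E :=
  toDirectSum E ∘ₗ DFinsupp.lsingle (M := fun i => (E i).carrier) i

theorem continuous_inclusion (i : ι) : Continuous (inclusion E i) := by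
  classical
  have h : ∀ ξ, ‖inclusion E i ξ‖ ≤ 1 * ‖ξ‖ := fun ξ => by
    rw [one_mul]
    refine le_of_sq_le_sq ?_ (by positivity)
    rw [(E i).norm_sq]
    let s : Π₀ i, E i := DFinsupp.single i ξ
    refine (((directSumPre E).norm_toCompletion_sq s).trans ?_).le
    congr 1
    change ∑ᶠ k, (E k).inner (s k) (s k) = _
    have hs : ∀ k, k ≠ i → s k = 0 := fun k hk => DFinsupp.single_eq_of_ne hk
    have hi : s i = ξ := DFinsupp.single_eq_same
    rw [finsum_eq_single _ i fun k hk => by rw [hs k hk, map_zero], hi]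
  exact (LinearMap.mkContinuous (inclusion E i) 1 h).continuous

variable {E} {A : Type v} [Ring A] [StarRing A] [Algebra ℂ A]

/-- The algebraic direct sum of representations. -/
def ClosedRep.directSumCore (π : ∀ i, ClosedRep A (E i)) :
    Core A (directSumModule E) (Π₀ i, (π i).dom) where
  ρ := AlgHom.ofLinearMap
    { toFun := fun a => DFinsupp.mapRange.linearMap fun i => (π i).op a
      map_add' := fun a b => by ext; simp
      map_smul' := fun c a => by ext; simp }
    (by ext; simp)
    (fun a b => by ext; simp)
  j := toDirectSum E ∘ₗ DFinsupp.mapRange.linearMap fun i => (π i).dom.subtype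
  act y d := DFinsupp.mapRange (fun i (x : (π i).dom) =>
    (⟨(E i).act x d, (π i).act_mem x x.2 d⟩ : (π i).dom)) (fun i => by ext; simp) y
  dense := by
    classical
    set L := LinearMap.range (toDirectSum E ∘ₗ
      DFinsupp.mapRange.linearMap fun i => (π i).dom.subtype) with hL
    have hle : LinearMap.range (toDirectSum E) ≤ L.topologicalClosure := by
      rintro _ ⟨t, rfl⟩
      induction t using DFinsupp.induction with
      | h0 => rw [map_zero]; exact Submodule.zero_mem _
      | ha i b f _ _ hf =>
        rw [map_add]
        refine Submodule.add_mem _ ?_ hf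
        have hcl : IsClosed {ξ : E i | inclusion E i ξ ∈ L.topologicalClosure} :=
          (Submodule.isClosed_topologicalClosure _).preimage (continuous_inclusion E i)
        have hb : b ∈ {ξ : E i | inclusion E i ξ ∈ L.topologicalClosure} := by
          refine closure_minimal (s := ((π i).dom : Set (E i))) ?_ hcl ((π i).dense b)
          intro x hx
          refine Submodule.le_topologicalClosure _ ⟨DFinsupp.single i ⟨x, hx⟩, ?_⟩
          change toDirectSum E (DFinsupp.mapRange.linearMap (fun i => (π i).dom.subtype) _) =
            toDirectSum E (DFinsupp.single i x)
          simp
        exact hb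
    refine dense_closure.1 ?_
    refine ((directSumPre E).denseRange_toCompletion).mono ?_
    rintro _ ⟨t, rfl⟩
    have := hle ⟨t, rfl⟩
    rwa [← SetLike.mem_coe, Submodule.topologicalClosure_coe, hL, LinearMap.coe_range] at this
  j_act a y d := by
    refine Eq.trans ?_ ((directSumPre E).act_toCompletion _ d).symm
    refine congrArg (toDirectSum E) ?_
    ext i
    exact (π i).op_act a (y i) d
  inner_j a y z := by
    refine ((directSumPre E).inner_toCompletion _ _).trans
      (Eq.trans ?_ ((directSumPre E).inner_toCompletion _ _).symm)
    exact finsum_congr fun i => (π i).symm a (y i) (z i)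

/-- The direct sum of closed representations on the Hilbert module direct sum. -/
def ClosedRep.directSum (π : ∀ i, ClosedRep A (E i)) : ClosedRep A (directSumModule E) :=
  (ClosedRep.directSumCore π).closure

end DirectSum

/-! ### Hilbert space representations of C⋆-algebras -/

section HilbertSpace

/-- The C⋆-algebra of complex numbers, in an arbitrary universe. -/
instance : StarRing (ULift.{u} ℂ) where
  star z := ⟨star z.down⟩
  star_involutive z := by ext; simp
  star_mul x y := by ext; simp [mul_comm]
  star_add x y := by ext; simp

instance : NonUnitalCStarAlgebra (ULift.{u} ℂ) where
  norm_mul_self_le z := (CStarRing.norm_star_mul_self (x := z.down)).ge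
  smul_assoc x y z := by ext; simp
  smul_comm x y z := by ext; simp
  star_smul c z := by ext; exact star_smul c z.down

/-- A Hilbert space as a Hilbert module over the complex numbers. -/
def ofHilbertSpace (H : Type u) [NormedAddCommGroup H] [InnerProductSpace ℂ H] [CompleteSpace H] :
    HilbertModule (ULift.{u} ℂ) where
  carrier := H
  act := LinearMap.mk₂ ℂ (fun x z => z.down • x) (fun x y z => smul_add _ _ _)
    (fun c x z => smul_comm _ _ _) (fun x y z => add_smul _ _ _) (fun c x z => smul_assoc _ _ _)
  inner := LinearMap.mk₂'ₛₗ (starRingEnd ℂ) (RingHom.id ℂ) (fun x y => ⟨inner ℂ x y⟩)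
    (fun x y z => by ext; exact inner_add_left x y z)
    (fun c x y => by ext; exact inner_smul_left x y c)
    (fun x y z => by ext; exact inner_add_right x y z)
    (fun c x y => by ext; exact inner_smul_right x y c)
  act_mul x d e := by
    change (d.down * e.down) • x = e.down • d.down • x
    rw [smul_smul, mul_comm]
  inner_act x y d := by
    ext
    change inner ℂ x (d.down • y) = inner ℂ x y * d.down
    rw [inner_smul_right, mul_comm]
  star_inner x y := by ext; exact inner_conj_symm y x
  inner_self_nonneg x := by
    refine ⟨⟨(‖x‖ : ℂ)⟩, ?_⟩
    ext
    change inner ℂ x x = star (‖x‖ : ℂ) * (‖x‖ : ℂ)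
    rw [inner_self_eq_norm_sq_to_K, Complex.star_def, Complex.conj_ofReal, sq]
    rfl
  inner_self_eq_zero x h := inner_self_eq_zero.1 (congrArg ULift.down h)
  norm_sq x := by
    change ‖x‖ ^ 2 = ‖inner ℂ x x‖
    rw [inner_self_eq_norm_sq_to_K]
    simp

variable {D : Type u} [NonUnitalCStarAlgebra D] {H : Type u} [NormedAddCommGroup H]
  [InnerProductSpace ℂ H] [CompleteSpace H]

/-- Nondegeneracy: the linear span of all `ρ(d) x` is dense. -/
def IsNondegenerate (ρ : D →⋆ₙₐ[ℂ] (H →L[ℂ] H)) : Prop :=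
  Dense (Submodule.span ℂ {y | ∃ d x, ρ d x = y} : Set H)

/-- Irreducibility: `H` is nonzero and has no closed invariant subspace besides `0` and `H`. -/
def IsIrreducible (ρ : D →⋆ₙₐ[ℂ] (H →L[ℂ] H)) : Prop :=
  Nontrivial H ∧ ∀ K : Submodule ℂ H, IsClosed (K : Set H) →
    (∀ d, ∀ x ∈ K, ρ d x ∈ K) → K = ⊥ ∨ K = ⊤

/-- A nondegenerate Hilbert space representation as a correspondence from `D` to `ℂ`. -/
def Correspondence.ofRep (ρ : D →⋆ₙₐ[ℂ] (H →L[ℂ] H)) (hρ : IsNondegenerate ρ) :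
    Correspondence D (ofHilbertSpace H) where
  left := ρ.toNonUnitalAlgHom
  inner_left d x y := by
    have h : ∀ x y : H, inner ℂ (ρ d x) y = inner ℂ x (ρ (star d) y) := fun x y => by
      rw [map_star, ContinuousLinearMap.star_eq_adjoint, ContinuousLinearMap.adjoint_inner_right]
    ext
    exact h x y
  nondegenerate := hρ

end HilbertSpace

/-! ### Classes of representations and submodule conditions -/

section Classes

variable {A : Type v} [Ring A] [StarRing A] [Algebra ℂ A]

/-- A unitary ⋆-intertwiner `u` between two representations on Hilbert `D`-modules: a unitary
operator such that both `u` and `u⋆ = u⁻¹` map the domains into each other and intertwine the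
representations. -/
structure UnitaryIntertwiner {D : Type u} [NonUnitalCStarAlgebra D] {E₁ E₂ : HilbertModule D}
    (π₁ : ClosedRep A E₁) (π₂ : ClosedRep A E₂) where
  u : E₁ ≃ₗ[ℂ] E₂
  map_act : ∀ x d, u (E₁.act x d) = E₂.act (u x) d
  inner_map : ∀ x y, E₂.inner (u x) (u y) = E₁.inner x y
  map_dom : ∀ x : E₁, u x ∈ π₂.dom ↔ x ∈ π₁.dom
  intertwines : ∀ (a : A) (x : π₁.dom),
    u (π₁.op a x) = π₂.op a ⟨u x, (map_dom x).2 x.2⟩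

variable (A) in
/-- A class of (closed) representations of `A` on Hilbert modules over C⋆-algebras. -/
def RepClass : Type (max (u + 1) v) :=
  ∀ (D : Type u) [NonUnitalCStarAlgebra D] (E : HilbertModule D), ClosedRep A E → Prop

/-- Weakly admissible classes: invariant under unitary ⋆-intertwiners, under interior tensor
products with correspondences, and under direct sums and summands. -/
structure RepClass.WeaklyAdmissible (R : RepClass.{u} A) : Prop where
  unitary : ∀ {D : Type u} [NonUnitalCStarAlgebra D] {E₁ E₂ : HilbertModule D}
    {π₁ : ClosedRep A E₁} {π₂ : ClosedRep A E₂}, UnitaryIntertwiner π₁ π₂ → R D E₁ π₁ → R D E₂ π₂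
  tensor : ∀ {D₁ D₂ : Type u} [NonUnitalCStarAlgebra D₁] [NonUnitalCStarAlgebra D₂]
    {E : HilbertModule D₁} {F : HilbertModule D₂} (G : Correspondence D₁ F) (π : ClosedRep A E),
    R D₁ E π → R D₂ (interiorTensor E G) (π.tensor G)
  directSum : ∀ {D : Type u} [NonUnitalCStarAlgebra D] {ι : Type u} {E : ι → HilbertModule D}
    (π : ∀ i, ClosedRep A (E i)),
    R D (directSumModule E) (ClosedRep.directSum π) ↔ ∀ i, R D (E i) (π i)

/-- A natural construction of Hilbert submodules of rank `n` for the representations in the class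
`R`. It associates to each representation `π` in `R` on `E` a closed `D`-submodule of `Eⁿ`,
compatibly with unitary ⋆-intertwiners, interior tensor products and direct sums. -/
structure NaturalSubmodule (R : RepClass.{u} A) (n : ℕ) where
  obj : ∀ {D : Type u} [NonUnitalCStarAlgebra D] {E : HilbertModule D} (π : ClosedRep A E),
    R D E π → Submodule ℂ (Fin n → E)
  isClosed : ∀ {D : Type u} [NonUnitalCStarAlgebra D] {E : HilbertModule D} (π : ClosedRep A E)
    (h : R D E π), IsClosed (obj π h : Set (Fin n → E))
  act_mem : ∀ {D : Type u} [NonUnitalCStarAlgebra D] {E : HilbertModule D} (π : ClosedRep A E)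
    (h : R D E π), ∀ ξ ∈ obj π h, ∀ d, (fun k => E.act (ξ k) d) ∈ obj π h
  unitary : ∀ {D : Type u} [NonUnitalCStarAlgebra D] {E₁ E₂ : HilbertModule D}
    {π₁ : ClosedRep A E₁} {π₂ : ClosedRep A E₂} (U : UnitaryIntertwiner π₁ π₂)
    (h₁ : R D E₁ π₁) (h₂ : R D E₂ π₂),
    (fun (ξ : Fin n → E₁) k => U.u (ξ k)) '' (obj π₁ h₁) = obj π₂ h₂
  /-- Under `Eⁿ ⊗ F ≅ (E ⊗ F)ⁿ`, the submodule `obj π ⊗ F` becomes the closed linear span of the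
  elements `(ξ₁ ⊗ η, …, ξₙ ⊗ η)` with `ξ ∈ obj π` and `η ∈ F`. -/
  tensor : ∀ {D₁ D₂ : Type u} [NonUnitalCStarAlgebra D₁] [NonUnitalCStarAlgebra D₂]
    {E : HilbertModule D₁} {F : HilbertModule D₂} (G : Correspondence D₁ F) (π : ClosedRep A E)
    (h : R D₁ E π) (h' : R D₂ (interiorTensor E G) (π.tensor G)),
    obj (π.tensor G) h' = (Submodule.span ℂ {ζ : Fin n → interiorTensor E G |
      ∃ ξ ∈ obj π h, ∃ η : F, ζ = fun k => toInterior E G (ξ k ⊗ₜ η)}).topologicalClosure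
  /-- Under `(⨁ Eᵢ)ⁿ ≅ ⨁ Eᵢⁿ`, the submodule `⨁ obj πᵢ` becomes the closed linear span of the
  images of the submodules `obj πᵢ ⊆ Eᵢⁿ`. -/
  directSum : ∀ {D : Type u} [NonUnitalCStarAlgebra D] {ι : Type u} {E : ι → HilbertModule D}
    (π : ∀ i, ClosedRep A (E i)) (h : ∀ i, R D (E i) (π i))
    (h' : R D (directSumModule E) (ClosedRep.directSum π)),
    obj (ClosedRep.directSum π) h' = (Submodule.span ℂ {ζ : Fin n → directSumModule E |
      ∃ i, ∃ ξ ∈ obj (π i) (h i), ζ = fun k => inclusion E i (ξ k)}).topologicalClosure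

/-- The class `R'` is defined inside `R` by a submodule condition: there are two natural
constructions of Hilbert submodules of the same rank `n ≥ 1`, and `R'` consists of those
representations in `R` for which the two submodules are equal. -/
def RepClass.DefinedBySubmoduleCondition (R R' : RepClass.{u} A) : Prop :=
  ∃ (n : ℕ) (_ : 1 ≤ n) (F₁ F₂ : NaturalSubmodule R n),
    ∀ (D : Type u) [NonUnitalCStarAlgebra D] (E : HilbertModule D) (π : ClosedRep A E),
      R' D E π ↔ ∃ h : R D E π, F₁.obj π h = F₂.obj π h

/-- The class `R` is defined by submodule conditions, by transfinite recursion along a well-ordered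
set `I` with a least and a greatest element: the recursion starts with the class of all (closed)
representations, uses a submodule condition in each successor step, takes intersections at limit
elements, and ends with `R`. -/
def RepClass.DefinedBySubmoduleConditions (R : RepClass.{u} A) : Prop :=
  ∃ (I : Type w) (_ : LinearOrder I) (_ : WellFoundedLT I) (_ : OrderBot I) (_ : OrderTop I)
    (C : I → RepClass.{u} A),
    (∀ (D : Type u) [NonUnitalCStarAlgebra D] (E : HilbertModule D) (π : ClosedRep A E),
      C ⊥ D E π) ∧
    C ⊤ = R ∧
    (∀ i j : I, i ⋖ j → (C i).DefinedBySubmoduleCondition (C j)) ∧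
    (∀ i : I, Order.IsSuccLimit i →
      ∀ (D : Type u) [NonUnitalCStarAlgebra D] (E : HilbertModule D) (π : ClosedRep A E),
        C i D E π ↔ ∀ j < i, C j D E π)

/-- The Strong Local–Global Principle for a (weakly admissible) class of representations: a
representation `π` on a Hilbert `D`-module belongs to the class if and only if `π ⊗_ρ 1` belongs to
it for all irreducible (nondegenerate) Hilbert space representations `ρ` of `D`. -/
def RepClass.StrongLocalGlobalPrinciple (R : RepClass.{u} A) : Prop :=
  R.WeaklyAdmissible ∧
  ∀ (D : Type u) [NonUnitalCStarAlgebra D] (E : HilbertModule D) (π : ClosedRep A E),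
    R D E π ↔
      ∀ (H : Type u) [NormedAddCommGroup H] [InnerProductSpace ℂ H] [CompleteSpace H]
        (ρ : D →⋆ₙₐ[ℂ] (H →L[ℂ] H)) (hρ : IsNondegenerate ρ), IsIrreducible ρ →
          R (ULift.{u} ℂ) (interiorTensor E (Correspondence.ofRep ρ hρ))
            (π.tensor (Correspondence.ofRep ρ hρ))

end Classes

end StarRep

end

/-! The heart of the matter is a local–global principle for Hilbert submodules
(`submodule_le_of_irreducible`): an inclusion between closed submodules of `Eⁿ` can be checked after
tensoring with the irreducible representations of `D`. Once this is known, equality of two natural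
submodules of a representation is detected by irreducible representations, because natural
constructions commute with tensor products. Weak admissibility follows from the naturality clauses,
and transfinite induction along the well-ordered set finishes the proof.

To prove the principle, let `F` be a closed submodule and `ξ` a vector. Each positive functional `φ`
of norm at most `1` gives a squared distance `d(φ) = inf_f φ(⟨ξ - f, ξ - f⟩)` over `f ∈ F`. If `φ`
is a nonzero extreme point of the set of such functionals, then its GNS representation is
irreducible, and the assumption in that representation, with its cyclic vector, says `d(φ) = 0`.

The passage from extreme points to all `φ` is a Bauer-type maximum principle. As an infimum of
continuous affine functions, `d` is upper semicontinuous and concave. It is also convex, because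
there are approximate projections: `exists_approx_projection_finset` replaces finitely many elements
of `F` by a single one that is nearly as close to `ξ` as each of them, in all functionals
simultaneously. Hence the set where `d` attains its maximum is a compact extreme set. By
Krein–Milman it contains an extreme point, so the maximum is `0`. Compactness and one more common
approximation then make `‖⟨ξ - f, ξ - f⟩‖` small for one `f ∈ F`, so `ξ` lies in the closure of `F`.
-/

noncomputable section

namespace StarRep

open scoped ComplexOrder

/-! ### Quasi-states -/

/-- The positive linear functionals of norm at most `1` on a C⋆-algebra, as a subset of the space
of all functions with the topology of pointwise convergence. -/
def quasiStates (D : Type u) [NonUnitalCStarAlgebra D] : Set (D → ℂ) :=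
  {φ | (∀ a b, φ (a + b) = φ a + φ b) ∧ (∀ (c : ℂ) a, φ (c • a) = c * φ a) ∧
    (∀ a, 0 ≤ φ (star a * a)) ∧ ∀ a, ‖φ a‖ ≤ ‖a‖}

section QuasiStates

variable {D : Type u} [NonUnitalCStarAlgebra D]

theorem isClosed_quasiStates : IsClosed (quasiStates D) := by
  simp only [quasiStates, Set.ofPred_and, Set.ofPred_forall]
  refine IsClosed.inter ?_ (IsClosed.inter ?_ (IsClosed.inter ?_ ?_))
  · exact isClosed_iInter fun a => isClosed_iInter fun b =>
      isClosed_eq (by fun_prop) (by fun_prop)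
  · exact isClosed_iInter fun a => isClosed_iInter fun b =>
      isClosed_eq (by fun_prop) (by fun_prop)
  · exact isClosed_iInter fun a => isClosed_le (by fun_prop) (by fun_prop)
  · exact isClosed_iInter fun a => isClosed_le (by fun_prop) (by fun_prop)

/-- Banach–Alaoglu through Tychonoff: the norm bound puts the set inside a product of discs.
Compactness is the reason for allowing norm less than `1`; the states of a nonunital algebra need
not form a closed set. -/
theorem isCompact_quasiStates : IsCompact (quasiStates D) := by
  refine (isCompact_univ_pi fun a : D =>
    isCompact_closedBall (0 : ℂ) ‖a‖).of_isClosed_subset isClosed_quasiStates ?_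
  intro φ hφ a _
  rw [mem_closedBall_zero_iff]
  exact hφ.2.2.2 a

theorem zero_mem_quasiStates : (0 : D → ℂ) ∈ quasiStates D :=
  ⟨fun _ _ => by simp, fun _ _ => by simp, fun _ => le_rfl, fun _ => by simp⟩

/-- A quasi-state as a linear map. -/
def quasiStates.toLinearMap {φ : D → ℂ} (hφ : φ ∈ quasiStates D) : D →ₗ[ℂ] ℂ where
  toFun := φ
  map_add' := hφ.1
  map_smul' := hφ.2.1

theorem quasiStates.map_sub {φ : D → ℂ} (hφ : φ ∈ quasiStates D) (a b : D) :
    φ (a - b) = φ a - φ b :=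
  _root_.map_sub (toLinearMap hφ) a b

theorem quasiStates.re_nonneg {φ : D → ℂ} (hφ : φ ∈ quasiStates D) (a : D) :
    0 ≤ (φ (star a * a)).re := (Complex.le_def.1 (hφ.2.2.1 a)).1

theorem quasiStates.re_le_norm {φ : D → ℂ} (hφ : φ ∈ quasiStates D) (a : D) :
    (φ a).re ≤ ‖a‖ := (Complex.re_le_norm _).trans (hφ.2.2.2 a)

/-- A quasi-state as a positive linear map. -/
def quasiStates.toPositive [PartialOrder D] [StarOrderedRing D] {φ : D → ℂ}
    (hφ : φ ∈ quasiStates D) : D →ₚ[ℂ] ℂ :=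
  PositiveLinearMap.mk₀ (toLinearMap hφ) fun a ha => by
    obtain ⟨b, rfl⟩ := CStarAlgebra.nonneg_iff_eq_star_mul_self.1 ha
    exact hφ.2.2.1 b

/-- The Cauchy–Schwarz inequality against an approximate unit. -/
theorem quasiStates.norm_sq_le {φ : D → ℂ} (hφ : φ ∈ quasiStates D) (d : D) :
    ‖φ d‖ ^ 2 ≤ (φ (star d * d)).re := by
  let _ : PartialOrder D := CStarAlgebra.spectralOrder D
  have _ : StarOrderedRing D := CStarAlgebra.spectralOrderedRing D
  let f := toPositive hφ
  have hcont : Continuous φ := (map_continuous f :)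
  have hl := CStarAlgebra.increasingApproximateUnit D
  have ht : Filter.Tendsto (fun e => ‖φ (e * d)‖ ^ 2) (CStarAlgebra.approximateUnit D)
      (nhds (‖φ d‖ ^ 2)) :=
    (((hcont.tendsto d).comp (hl.tendsto_mul_right d)).norm).pow 2
  refine le_of_tendsto ht ?_
  filter_upwards [hl.eventually_star_eq, hl.eventually_norm] with e hs hn
  have h := norm_inner_le_norm (𝕜 := ℂ) (f.toPreGNS e) (f.toPreGNS d)
  have he : ‖f.toPreGNS e‖ ^ 2 ≤ 1 := by
    rw [f.preGNS_norm_def]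
    refine (Real.sq_sqrt (re_nonneg hφ e)).trans_le ((re_le_norm hφ _).trans ?_)
    rw [CStarRing.norm_star_mul_self]
    exact mul_le_one₀ hn (norm_nonneg _) hn
  have hd : ‖f.toPreGNS d‖ ^ 2 = (φ (star d * d)).re := by
    rw [f.preGNS_norm_def]
    exact Real.sq_sqrt (re_nonneg hφ d)
  have hi : inner ℂ (f.toPreGNS e) (f.toPreGNS d) = φ (e * d) := by
    rw [f.preGNS_inner_def]
    change φ (star e * d) = _
    rw [hs]
  rw [hi] at h
  rw [← hd]
  calc ‖φ (e * d)‖ ^ 2 ≤ (‖f.toPreGNS e‖ * ‖f.toPreGNS d‖) ^ 2 := by gcongr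
    _ = ‖f.toPreGNS e‖ ^ 2 * ‖f.toPreGNS d‖ ^ 2 := mul_pow _ _ _
    _ ≤ 1 * ‖f.toPreGNS d‖ ^ 2 := by gcongr
    _ = _ := one_mul _

/-- A complex number in the unit disc, whose reflection at `1` is also in the unit disc. -/
theorem eq_one_of_norm_le_one {z : ℂ} (h1 : ‖z‖ ≤ 1) (h2 : ‖2 - z‖ ≤ 1) : z = 1 := by
  have a1 : z.re * z.re + z.im * z.im ≤ 1 := by
    rw [← Complex.normSq_apply, Complex.normSq_eq_norm_sq]
    exact pow_le_one₀ (norm_nonneg _) h1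
  have a2 : (2 - z).re * (2 - z).re + (2 - z).im * (2 - z).im ≤ 1 := by
    rw [← Complex.normSq_apply, Complex.normSq_eq_norm_sq]
    exact pow_le_one₀ (norm_nonneg _) h2
  simp only [Complex.sub_re, Complex.sub_im, Complex.re_ofNat, Complex.im_ofNat] at a2
  have h3 : (z.re - 1) ^ 2 + z.im ^ 2 ≤ 0 := by nlinarith
  have h4 : z.re - 1 = 0 := by nlinarith [sq_nonneg (z.re - 1), sq_nonneg z.im]
  have h5 : z.im = 0 := by nlinarith [sq_nonneg (z.re - 1), sq_nonneg z.im]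
  exact Complex.ext (by simp; linarith) (by simpa using h5)

/-- A functional of norm at most `1` with `g 1 = 1` on a unital C⋆-algebra is positive. -/
theorem nonneg_of_norm_le_one {B : Type*} [CStarAlgebra B] (g : B →L[ℂ] ℂ) (hg : ‖g‖ ≤ 1)
    (h1 : g 1 = 1) (b : B) : 0 ≤ g (star b * b) := by
  let _ : PartialOrder B := CStarAlgebra.spectralOrder B
  have _ : StarOrderedRing B := CStarAlgebra.spectralOrderedRing B
  have hn : ∀ x, ‖g x‖ ≤ ‖x‖ := fun x => (g.le_of_opNorm_le hg x).trans (one_mul _).le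
  have him : ∀ x : B, IsSelfAdjoint x → (g x).im = 0 := by
    intro x hx
    by_contra hne
    -- For self-adjoint `x` one has `‖x + it‖² ≤ ‖x‖² + t²`, while `|g x + it|²` contains the cross
    -- term `2 t Im (g x)`. Linear growth in `t` forces the imaginary part to vanish.
    have key : ∀ t : ℝ, 2 * t * (g x).im ≤ ‖x‖ ^ 2 := by
      intro t
      have hs : ‖x + (t * Complex.I) • (1 : B)‖ ^ 2 ≤ ‖x‖ ^ 2 + t ^ 2 * ‖(1 : B)‖ := by
        rw [sq, ← CStarRing.norm_star_mul_self]
        have e : star (x + (t * Complex.I) • (1 : B)) * (x + (t * Complex.I) • (1 : B)) =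
            star x * x + ((t ^ 2 : ℝ) : ℂ) • (1 : B) := by
          have h1 : star (t * Complex.I : ℂ) = -(t * Complex.I) := by simp
          have h2 : (t * Complex.I : ℂ) * (t * Complex.I) = -((t ^ 2 : ℝ) : ℂ) := by
            rw [mul_mul_mul_comm, Complex.I_mul_I]
            push_cast
            ring
          simp only [star_add, star_smul, star_one, hx.star_eq, add_mul, mul_add, smul_mul_assoc,
            one_mul, mul_smul_comm, mul_one, smul_add, h1, neg_smul, smul_neg, neg_mul]
          rw [smul_smul, h2, neg_smul]
          abel
        rw [e]
        refine (norm_add_le _ _).trans ?_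
        rw [CStarRing.norm_star_mul_self, ← sq, norm_smul, Complex.norm_real,
          Real.norm_of_nonneg (sq_nonneg t)]
      have h2 : ‖(1 : B)‖ ≤ 1 := by
        rcases subsingleton_or_nontrivial B with h | h
        · rw [Subsingleton.elim (1 : B) 0, norm_zero]; exact zero_le_one
        · rw [CStarRing.norm_one]
      have h3 := hn (x + (t * Complex.I) • (1 : B))
      rw [map_add, map_smul, h1, smul_eq_mul, mul_one] at h3
      have h4 : ‖g x + t * Complex.I‖ ^ 2 = (g x).re ^ 2 + ((g x).im + t) ^ 2 := by
        rw [← Complex.normSq_eq_norm_sq, Complex.normSq_apply]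
        simp
        ring
      have h5 : ‖g x + t * Complex.I‖ ^ 2 ≤ ‖x + (t * Complex.I) • (1 : B)‖ ^ 2 := by gcongr
      rw [h4] at h5
      nlinarith [sq_nonneg (g x).re, sq_nonneg (g x).im, sq_nonneg t]
    have := key ((‖x‖ ^ 2 + 1) / (2 * (g x).im))
    have h6 : 2 * ((‖x‖ ^ 2 + 1) / (2 * (g x).im)) * (g x).im = ‖x‖ ^ 2 + 1 := by
      field_simp
    linarith
  -- If `0 ≤ x ≤ 1`, then `‖1 - x‖ ≤ 1`, so `g x` lies in the unit disc around `1`.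
  have hre : ∀ x : B, 0 ≤ x → ‖x‖ ≤ 1 → 0 ≤ (g x).re := by
    intro x hx hx1
    have hle : x ≤ 1 := (CStarAlgebra.norm_le_one_iff_of_nonneg x hx).1 hx1
    have h3 : ‖1 - x‖ ≤ 1 := by
      rw [CStarAlgebra.norm_le_one_iff_of_nonneg (1 - x) (sub_nonneg.2 hle)]
      exact sub_le_self _ hx
    have h4 := (Complex.abs_re_le_norm _).trans ((hn (1 - x)).trans h3)
    rw [map_sub, h1, Complex.sub_re, Complex.one_re] at h4
    have := (abs_le.1 h4).2
    linarith
  have hsa : IsSelfAdjoint (star b * b) := IsSelfAdjoint.star_mul_self b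
  refine Complex.le_def.2 ⟨?_, (him _ hsa).symm⟩
  have h := hre ((‖star b * b‖ + 1)⁻¹ • (star b * b))
    (smul_nonneg (by positivity) (star_mul_self_nonneg b)) (by
      rw [norm_smul, norm_inv, Real.norm_of_nonneg (by positivity), inv_mul_le_iff₀ (by positivity)]
      linarith)
  rw [← Complex.coe_smul, map_smul, smul_eq_mul, Complex.re_ofReal_mul] at h
  exact (mul_nonneg_iff_of_pos_left (by positivity)).1 h

/-- This follows from `(2x - 1)² = 1 - 4(x - x²)` and `x² ≤ x`. It is used to show that a functional
of norm `1` attaining its norm at a positive element must take the value `1` at the unit. -/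
theorem norm_two_smul_sub_one_le {B : Type*} [CStarAlgebra B] [PartialOrder B] [StarOrderedRing B]
    {x : B} (hx0 : 0 ≤ x) (hx1 : x ≤ 1) : ‖(2 : ℂ) • x - 1‖ ≤ 1 := by
  have hs : star ((2 : ℂ) • x - 1) = (2 : ℂ) • x - 1 := by
    rw [star_sub, star_smul, star_one, (IsSelfAdjoint.of_nonneg hx0).star_eq]
    simp
  have hxx : x ^ 2 ≤ x ^ 1 := CStarAlgebra.pow_antitone hx0 hx1 one_le_two
  have hy : star ((2 : ℂ) • x - 1) * ((2 : ℂ) • x - 1) ≤ 1 := by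
    rw [hs, ← sub_nonneg]
    have : 1 - ((2 : ℂ) • x - 1) * ((2 : ℂ) • x - 1) = (4 : ℝ) • (x ^ 1 - x ^ 2) := by
      rw [two_smul, show (4 : ℝ) = 1 + 1 + 1 + 1 by norm_num]
      simp only [add_smul, one_smul]
      noncomm_ring
    rw [this]
    exact smul_nonneg (by norm_num) (sub_nonneg.2 hxx)
  rw [← CStarAlgebra.norm_le_one_iff_of_nonneg _ (star_mul_self_nonneg _),
    CStarRing.norm_star_mul_self] at hy
  nlinarith [norm_nonneg ((2 : ℂ) • x - 1)]

/-- Quasi-states detect the norm of positive elements. -/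
theorem exists_quasiState_apply_eq_norm (b : D) :
    ∃ φ ∈ quasiStates D, φ (star b * b) = ‖star b * b‖ := by
  by_cases hb : star b * b = 0
  · exact ⟨0, zero_mem_quasiStates, by simp [hb]⟩
  let B := Unitization ℂ D
  let _ : PartialOrder B := CStarAlgebra.spectralOrder B
  have _ : StarOrderedRing B := CStarAlgebra.spectralOrderedRing B
  set r : ℝ := ‖star b * b‖ with hr
  have hr0 : 0 < r := norm_pos_iff.2 hb
  let x : B := (r⁻¹ : ℝ) • ((star b * b : D) : B)
  have hxn : ‖x‖ = 1 := by
    rw [norm_smul, Unitization.norm_inr, norm_inv, Real.norm_of_nonneg hr0.le, ← hr,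
      inv_mul_cancel₀ hr0.ne']
  have hx0 : 0 ≤ x := by
    refine smul_nonneg (by positivity) ?_
    rw [Unitization.inr_mul, Unitization.inr_star]
    exact star_mul_self_nonneg _
  have hx1 : x ≤ 1 := (CStarAlgebra.norm_le_one_iff_of_nonneg x hx0).1 hxn.le
  -- Hahn–Banach provides a functional of norm `1` with `g x = 1`. Positivity is automatic once `g 1
  -- = 1`.
  obtain ⟨g, hg, hgx⟩ := exists_dual_vector ℂ x (by
    rw [hxn]; exact one_ne_zero)
  rw [hxn] at hgx
  have hn : ∀ x, ‖g x‖ ≤ ‖x‖ := fun x => (g.le_of_opNorm_le hg.le x).trans (one_mul _).le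
  -- Both `g 1` and its reflection `2 - g 1 = g (2x - 1)` lie in the closed unit disc, which leaves
  -- only `1`.
  have hg1 : g 1 = 1 := by
    refine eq_one_of_norm_le_one ((hn 1).trans CStarRing.norm_one.le) ?_
    have h2 : ‖(2 : ℂ) • x - 1‖ ≤ 1 := norm_two_smul_sub_one_le hx0 hx1
    have h3 := (hn _).trans h2
    rw [map_sub, map_smul, hgx] at h3
    simpa using h3
  refine ⟨fun d => g (d : B), ⟨fun a c => ?_, fun c a => ?_, fun a => ?_, fun a => ?_⟩, ?_⟩
  · simp
  · simp
  · change 0 ≤ g ((star a * a : D) : B)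
    rw [Unitization.inr_mul, Unitization.inr_star]
    exact nonneg_of_norm_le_one g hg.le hg1 _
  · exact (hn _).trans (Unitization.norm_inr (𝕜 := ℂ) a).le
  · have : ((star b * b : D) : B) = (r : ℂ) • x := by
      rw [Complex.coe_smul, smul_smul, mul_inv_cancel₀ hr0.ne', one_smul]
    change g ((star b * b : D) : B) = r
    rw [this, map_smul, hgx]
    simp

end QuasiStates

/-! ### GNS representations of quasi-states and irreducibility at extreme points. -/

section PureStates

variable {D : Type u} [NonUnitalCStarAlgebra D]

/-- The GNS representation of a quasi-state, with a cyclic vector. -/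
theorem exists_cyclic_rep {φ : D → ℂ} (hφ : φ ∈ quasiStates D) :
    ∃ (H : Type u) (_ : NormedAddCommGroup H) (_ : InnerProductSpace ℂ H) (_ : CompleteSpace H)
      (ρ : D →⋆ₙₐ[ℂ] (H →L[ℂ] H)) (η : H), DenseRange (fun d => ρ d η) ∧ ‖η‖ ≤ 1 ∧
        ∀ d, φ d = inner ℂ η (ρ d η) := by
  let _ : PartialOrder D := CStarAlgebra.spectralOrder D
  have _ : StarOrderedRing D := CStarAlgebra.spectralOrderedRing D
  let f := quasiStates.toPositive hφ
  have hf : ∀ x, ‖(quasiStates.toLinearMap hφ ∘ₗ f.ofPreGNS.toLinearMap) x‖ ≤ 1 * ‖x‖ := by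
    intro x
    rw [one_mul]
    refine le_of_sq_le_sq ?_ (norm_nonneg _)
    rw [f.preGNS_norm_def]
    exact (quasiStates.norm_sq_le hφ _).trans_eq
      (Real.sq_sqrt (quasiStates.re_nonneg hφ (f.ofPreGNS x))).symm
  -- Without a unit in `D`, no class of `1` is available as cyclic vector. Instead, `φ` itself is
  -- bounded in the GNS norm, by `quasiStates.norm_sq_le`, and the cyclic vector is its Riesz
  -- representative.
  let l : f.PreGNS →L[ℂ] ℂ := LinearMap.mkContinuous _ 1 hf
  let L : f.GNS →L[ℂ] ℂ := l.extend UniformSpace.Completion.toComplL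
  have hL : ∀ x : f.PreGNS, L x = l x := fun x =>
    ContinuousLinearMap.extend_eq _ UniformSpace.Completion.denseRange_coe
      (UniformSpace.Completion.isUniformInducing_coe _) x
  have hLn : ‖L‖ ≤ 1 := by
    refine L.opNorm_le_bound zero_le_one fun x => ?_
    refine UniformSpace.Completion.induction_on x
      (isClosed_le (by fun_prop) (by fun_prop)) fun a => ?_
    rw [hL, UniformSpace.Completion.norm_coe]
    exact hf a
  let η : f.GNS := (InnerProductSpace.toDual ℂ f.GNS).symm L
  have hη : ∀ x, inner ℂ η x = L x := fun x => InnerProductSpace.toDual_symm_apply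
  -- Against the dense set of classes of `a ∈ D`, both sides have inner product `φ(d⋆a)`. This
  -- yields cyclicity and `φ d = ⟨η, ρ(d)η⟩` together.
  have hρ : ∀ d, f.gnsNonUnitalStarAlgHom d η = (f.toPreGNS d : f.GNS) := by
    intro d
    refine ext_inner_right ℂ fun v => ?_
    refine UniformSpace.Completion.induction_on v
      (isClosed_eq (by fun_prop) (by fun_prop)) fun a => ?_
    rw [← ContinuousLinearMap.adjoint_inner_right, ← ContinuousLinearMap.star_eq_adjoint,
      ← map_star, f.gnsNonUnitalStarAlgHom_apply_coe, hη, hL,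
      UniformSpace.Completion.inner_coe, f.preGNS_inner_def]
    rfl
  refine ⟨f.GNS, inferInstance, inferInstance, inferInstance, f.gnsNonUnitalStarAlgHom, η,
    ?_, ?_, ?_⟩
  · refine (UniformSpace.Completion.denseRange_coe (α := f.PreGNS)).mono ?_
    rintro _ ⟨x, rfl⟩
    exact ⟨f.ofPreGNS x, hρ _⟩
  · rw [LinearIsometryEquiv.norm_map]
    exact hLn
  · intro d
    rw [hρ, hη, hL]
    rfl

theorem isNondegenerate_of_cyclic {H : Type u} [NormedAddCommGroup H] [InnerProductSpace ℂ H]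
    [CompleteSpace H] {ρ : D →⋆ₙₐ[ℂ] (H →L[ℂ] H)} {η : H} (h : DenseRange fun d => ρ d η) :
    IsNondegenerate ρ := by
  refine h.mono ?_
  rintro _ ⟨d, rfl⟩
  exact Submodule.subset_span ⟨d, η, rfl⟩

/-- Supplies the two endpoints of the segment through `φ` that an invariant subspace of its GNS
representation produces. -/
theorem smul_vectorState_mem_quasiStates {H : Type u} [NormedAddCommGroup H]
    [InnerProductSpace ℂ H] [CompleteSpace H] (ρ : D →⋆ₙₐ[ℂ] (H →L[ℂ] H)) (v : H) {r : ℝ}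
    (hr : 0 ≤ r) (hv : r * ‖v‖ ^ 2 ≤ 1) :
    (fun d => (r : ℂ) * inner ℂ v (ρ d v)) ∈ quasiStates D := by
  refine ⟨fun a b => ?_, fun c a => ?_, fun a => ?_, fun a => ?_⟩
  · simp [mul_add]
  · simp; ring
  · refine mul_nonneg (by exact_mod_cast hr) ?_
    rw [map_mul, map_star, mul_apply_eq_comp, ContinuousLinearMap.star_eq_adjoint,
      ContinuousLinearMap.adjoint_inner_right, inner_self_eq_norm_sq_to_K]
    rw [← RCLike.ofReal_pow]
    exact Complex.zero_le_real.2 (sq_nonneg _)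
  · rw [norm_mul, Complex.norm_real, Real.norm_of_nonneg hr]
    have h1 : ‖ρ a‖ ≤ ‖a‖ := NonUnitalStarAlgHom.norm_apply_le ρ a
    calc r * ‖inner ℂ v (ρ a v)‖ ≤ r * (‖v‖ * (‖a‖ * ‖v‖)) := by
          gcongr
          exact (norm_inner_le_norm _ _).trans (by gcongr; exact (ρ a).le_of_opNorm_le h1 v)
      _ = (r * ‖v‖ ^ 2) * ‖a‖ := by ring
      _ ≤ 1 * ‖a‖ := by gcongr
      _ = ‖a‖ := one_mul _

/-- The GNS representation of a nonzero extreme quasi-state is irreducible. -/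
theorem isIrreducible_of_extreme {φ : D → ℂ} (hφ : φ ∈ (quasiStates D).extremePoints ℝ)
    (h0 : φ ≠ 0) {H : Type u} [NormedAddCommGroup H] [InnerProductSpace ℂ H] [CompleteSpace H]
    {ρ : D →⋆ₙₐ[ℂ] (H →L[ℂ] H)} {η : H} (hd : DenseRange fun d => ρ d η) (hη : ‖η‖ ≤ 1)
    (hφη : ∀ d, φ d = inner ℂ η (ρ d η)) : IsIrreducible ρ := by
  have hη0 : η ≠ 0 := by
    rintro rfl
    exact h0 (funext fun d => by rw [hφη]; simp)
  refine ⟨⟨η, 0, hη0⟩, fun K hK hinv => ?_⟩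
  have _ : CompleteSpace K := hK.completeSpace_coe
  have hadj : ∀ d x y, inner ℂ (ρ d x) y = inner ℂ x (ρ (star d) y) := fun d x y => by
    rw [map_star, ContinuousLinearMap.star_eq_adjoint, ContinuousLinearMap.adjoint_inner_right]
  have hperp : ∀ d, ∀ x ∈ Kᗮ, ρ d x ∈ Kᗮ := by
    intro d x hx
    rw [Submodule.mem_orthogonal] at hx ⊢
    intro y hy
    have := hadj (star d) y x
    rw [star_star] at this
    rw [← this]
    exact hx _ (hinv _ _ hy)
  -- The cyclic vector is split along the invariant subspace and its invariant complement. If one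
  -- component vanishes, cyclicity makes `K` equal to `⊤` or `⊥`; two nonzero components contradict
  -- extremality.
  obtain ⟨p, hp, q, hq, hpq⟩ : ∃ p ∈ K, ∃ q ∈ Kᗮ, η = p + q :=
    Submodule.exists_add_mem_mem_orthogonal η
  have hKp : q = 0 → K = ⊤ := by
    rintro rfl
    rw [add_zero] at hpq
    refine (Submodule.eq_top_iff').2 fun x => ?_
    refine closure_minimal ?_ hK (hd x)
    rintro _ ⟨d, rfl⟩
    rw [hpq]
    exact hinv d p hp
  have hKq : p = 0 → K = ⊥ := by
    rintro rfl
    rw [zero_add] at hpq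
    rw [← Submodule.orthogonal_eq_top_iff, Submodule.eq_top_iff']
    intro x
    refine closure_minimal ?_ (Submodule.isClosed_orthogonal K) (hd x)
    rintro _ ⟨d, rfl⟩
    rw [hpq]
    exact hperp d q hq
  by_cases hp0 : p = 0
  · exact Or.inl (hKq hp0)
  by_cases hq0 : q = 0
  · exact Or.inr (hKp hq0)
  exfalso
  have hnorm : ‖p‖ ^ 2 + ‖q‖ ^ 2 ≤ 1 := by
    have h1 : ‖p + q‖ * ‖p + q‖ = ‖p‖ * ‖p‖ + ‖q‖ * ‖q‖ :=
      norm_add_sq_eq_norm_sq_add_norm_sq_of_inner_eq_zero p q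
        (Submodule.inner_right_of_mem_orthogonal hp hq)
    rw [← hpq] at h1
    nlinarith [norm_nonneg η]
  have hp1 : 0 < ‖p‖ ^ 2 := by positivity
  have hq1 : 0 < ‖q‖ ^ 2 := by positivity
  have hlt : 0 < 1 - ‖p‖ ^ 2 := by linarith
  have hsum : ∀ d, φ d = inner ℂ p (ρ d p) + inner ℂ q (ρ d q) := by
    intro d
    rw [hφη, hpq, map_add, inner_add_left, inner_add_right, inner_add_right,
      Submodule.inner_right_of_mem_orthogonal hp (hperp d q hq),
      Submodule.inner_left_of_mem_orthogonal (hinv d p hp) hq]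
    ring
  have h1 := smul_vectorState_mem_quasiStates ρ p (r := (‖p‖ ^ 2)⁻¹) (by positivity)
    (inv_mul_cancel₀ hp1.ne').le
  have h2 := smul_vectorState_mem_quasiStates ρ q (r := (1 - ‖p‖ ^ 2)⁻¹) (by positivity)
    (by rw [inv_mul_le_iff₀ hlt]; linarith)
  -- The weights are `‖p‖²` and `1 - ‖p‖²` rather than `‖q‖²`, because only `‖η‖ ≤ 1` is known. The
  -- second endpoint is still a quasi-state because `‖q‖² ≤ 1 - ‖p‖²`.
  have hmem : φ ∈ openSegment ℝ (fun d => (((‖p‖ ^ 2)⁻¹ : ℝ) : ℂ) * inner ℂ p (ρ d p))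
      (fun d => (((1 - ‖p‖ ^ 2)⁻¹ : ℝ) : ℂ) * inner ℂ q (ρ d q)) := by
    refine ⟨‖p‖ ^ 2, 1 - ‖p‖ ^ 2, hp1, hlt, by ring, ?_⟩
    funext d
    rw [hsum]
    simp only [Pi.add_apply, Pi.smul_apply]
    rw [← Complex.coe_smul, ← Complex.coe_smul, smul_eq_mul, smul_eq_mul, ← mul_assoc,
      ← mul_assoc, ← Complex.ofReal_mul, ← Complex.ofReal_mul, mul_inv_cancel₀ hp1.ne',
      mul_inv_cancel₀ hlt.ne', Complex.ofReal_one, one_mul, one_mul]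
  have heq := hφ.2 h1 h2 hmem
  -- Extremality gives `⟨p, ρ(d)p⟩ = ‖p‖² φ(d)`, so both sides have the same inner product with
  -- every `ρ(d)η`. Then `p` and `q` are nonzero multiples of `η` that are orthogonal to each other,
  -- which is absurd.
  have hpη : p = ((‖p‖ ^ 2 : ℝ) : ℂ) • η := by
    refine ext_inner_right ℂ fun x => ?_
    refine hd.induction_on (p := fun x => inner ℂ p x = inner ℂ (((‖p‖ ^ 2 : ℝ) : ℂ) • η) x) x
      (isClosed_eq (by fun_prop) (by fun_prop)) fun d => ?_
    have h3 : inner ℂ p (ρ d η) = inner ℂ p (ρ d p) := by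
      rw [hpq, map_add, inner_add_right,
        Submodule.inner_right_of_mem_orthogonal hp (hperp d q hq), add_zero]
    rw [inner_smul_left, Complex.conj_ofReal, ← hφη, h3, ← congrFun heq d, ← mul_assoc,
      ← Complex.ofReal_mul, mul_inv_cancel₀ hp1.ne', Complex.ofReal_one, one_mul]
  have hqη : q = ((1 - ‖p‖ ^ 2 : ℝ) : ℂ) • η := by
    rw [Complex.ofReal_sub, sub_smul, ← hpη, Complex.ofReal_one, one_smul, hpq]
    abel
  have hz : inner ℂ p q = 0 := Submodule.inner_right_of_mem_orthogonal hp hq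
  rw [hqη, inner_smul_right] at hz
  nth_rw 2 [hpη] at hz
  rw [inner_smul_left, Complex.conj_ofReal] at hz
  have h3 := (mul_eq_zero.1 hz).resolve_left (by exact_mod_cast hlt.ne')
  have h4 := (mul_eq_zero.1 h3).resolve_left (by exact_mod_cast hp1.ne')
  exact hη0 (inner_self_eq_zero.1 h4)

end PureStates

/-! ### Functional calculus: an approximate inverse of a positive element. -/

section Cutoff

variable {D : Type u} [NonUnitalCStarAlgebra D]

/-- The projection onto `f · D` would need the inverse of `G = ⟨f, f⟩`. The regularised inverse `k =
κ(G)` with `κ(s) = s / (s² + ε²)` replaces it; since `κ(0) = 0`, it exists without a unit. The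
element `m` is the one that appears in the squared length of the corrected vector. On the spectrum
`1 - sμ(s) = (1 - sκ(s))²`, so the two defects are `s(1 - sκ)²` and `s(1 - sκ)⁴`. Both are at most
`ε`, because `0 ≤ 1 - sκ ≤ 1` and `s(1 - sκ) = sε² / (s² + ε²) ≤ ε`. -/
theorem exists_cutoff [PartialOrder D] [StarOrderedRing D] {G : D} (hG : 0 ≤ G) {ε : ℝ}
    (hε : 0 < ε) : ∃ k m : D, IsSelfAdjoint k ∧ m = k + k - k * G * k ∧ 0 ≤ m ∧
      ‖G - G * m * G‖ ≤ ε ∧ ‖G - G * m * G - G * m * G + G * m * G * m * G‖ ≤ ε := by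
  have hpos : ∀ s : ℝ, 0 < s ^ 2 + ε ^ 2 := fun s => by positivity
  obtain ⟨κ, hκs⟩ : ∃ κ : ℝ → ℝ, ∀ s, κ s = s / (s ^ 2 + ε ^ 2) := ⟨_, fun _ => rfl⟩
  obtain ⟨μ, hμs⟩ : ∃ μ : ℝ → ℝ, ∀ s, μ s = κ s + κ s - κ s * s * κ s := ⟨_, fun _ => rfl⟩
  have hκ : Continuous κ := by
    rw [funext hκs]
    exact Continuous.div (by fun_prop) (by fun_prop) fun s => (hpos s).ne'
  have hκ0 : κ 0 = 0 := by simp [hκs]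
  have hμ : Continuous μ := by rw [funext hμs]; fun_prop
  have hμ0 : μ 0 = 0 := by simp [hμs, hκ0]
  have hsa : IsSelfAdjoint G := IsSelfAdjoint.of_nonneg hG
  have hid : cfcₙ (fun s : ℝ => s) G = G := cfcₙ_id' ℝ G
  have hspec : ∀ s ∈ quasispectrum ℝ G, 0 ≤ s := fun s hs =>
    quasispectrum_nonneg_of_nonneg G hG s hs
  have hu : ∀ s : ℝ, 1 - s * κ s = ε ^ 2 / (s ^ 2 + ε ^ 2) := fun s => by
    have := (hpos s).ne'
    rw [hκs]
    field_simp
    ring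
  have hu0 : ∀ s : ℝ, 0 ≤ 1 - s * κ s := fun s => by rw [hu]; positivity
  have hu1 : ∀ s : ℝ, 1 - s * κ s ≤ 1 := fun s => by
    rw [hu, div_le_one (hpos s)]
    nlinarith [sq_nonneg s]
  have hsu : ∀ s : ℝ, s * (1 - s * κ s) ≤ ε := fun s => by
    rw [hu, mul_div_assoc', div_le_iff₀ (hpos s)]
    nlinarith [mul_nonneg hε.le (sq_nonneg (s - ε)), mul_nonneg hε.le (sq_nonneg s),
      mul_nonneg hε.le (sq_nonneg ε), mul_nonneg hε.le (sq_nonneg (s + ε))]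
  have mul : ∀ {f g : ℝ → ℝ}, Continuous f → f 0 = 0 → Continuous g → g 0 = 0 →
      cfcₙ (fun s => f s * g s) G = cfcₙ f G * cfcₙ g G := fun hf hf0 hg hg0 =>
    cfcₙ_mul _ _ G hf.continuousOn hf0 hg.continuousOn hg0
  have sub : ∀ {f g : ℝ → ℝ}, Continuous f → f 0 = 0 → Continuous g → g 0 = 0 →
      cfcₙ (fun s => f s - g s) G = cfcₙ f G - cfcₙ g G := fun hf hf0 hg hg0 =>
    cfcₙ_sub _ _ G hf.continuousOn hf0 hg.continuousOn hg0
  have add : ∀ {f g : ℝ → ℝ}, Continuous f → f 0 = 0 → Continuous g → g 0 = 0 →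
      cfcₙ (fun s => f s + g s) G = cfcₙ f G + cfcₙ g G := fun hf hf0 hg hg0 =>
    cfcₙ_add _ _ G hf.continuousOn hf0 hg.continuousOn hg0
  have hm : cfcₙ μ G = cfcₙ κ G + cfcₙ κ G - cfcₙ κ G * G * cfcₙ κ G := by
    rw [funext hμs, sub (by fun_prop) (by simp [hκ0]) (by fun_prop) (by simp),
      add hκ hκ0 hκ hκ0, mul (by fun_prop) (by simp) hκ hκ0, mul hκ hκ0 continuous_id' rfl, hid]
  have hGm : cfcₙ (fun s => s * μ s) G = G * cfcₙ μ G := by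
    rw [mul continuous_id' rfl hμ hμ0, hid]
  have hGmG : cfcₙ (fun s => s * μ s * s) G = G * cfcₙ μ G * G := by
    rw [mul (by fun_prop) (by simp) continuous_id' rfl, hid, hGm]
  have hGmGmG : cfcₙ (fun s => s * μ s * s * μ s * s) G =
      G * cfcₙ μ G * G * cfcₙ μ G * G := by
    rw [mul (by fun_prop) (by simp) continuous_id' rfl, mul (by fun_prop) (by simp) hμ hμ0, hid,
      hGmG]
  have hd : cfcₙ (fun s => s - s * μ s * s) G = G - G * cfcₙ μ G * G := by
    rw [sub continuous_id' rfl (by fun_prop) (by simp), hid, hGmG]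
  have hd2 : cfcₙ (fun s => s - s * μ s * s - s * μ s * s + s * μ s * s * μ s * s) G =
      G - G * cfcₙ μ G * G - G * cfcₙ μ G * G + G * cfcₙ μ G * G * cfcₙ μ G * G := by
    rw [add (by fun_prop) (by simp) (by fun_prop) (by simp),
      sub (by fun_prop) (by simp) (by fun_prop) (by simp), hGmGmG, hd, hGmG]
  refine ⟨cfcₙ κ G, cfcₙ μ G, cfcₙ_predicate κ G, hm, ?_, ?_, ?_⟩
  · refine cfcₙ_nonneg fun s hs => ?_
    have hs0 := hspec s hs
    have hk0 : 0 ≤ κ s := by rw [hκs]; exact div_nonneg hs0 (hpos s).le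
    have : μ s = κ s * (1 + (1 - s * κ s)) := by rw [hμs]; ring
    rw [this]
    exact mul_nonneg hk0 (by linarith [hu0 s])
  · rw [← hd]
    refine norm_cfcₙ_le fun s hs => ?_
    have hs0 := hspec s hs
    have e : s - s * μ s * s = s * (1 - s * κ s) * (1 - s * κ s) := by rw [hμs]; ring
    rw [e, Real.norm_of_nonneg (mul_nonneg (mul_nonneg hs0 (hu0 s)) (hu0 s))]
    exact (mul_le_of_le_one_right (mul_nonneg hs0 (hu0 s)) (hu1 s)).trans (hsu s)
  · rw [← hd2]
    refine norm_cfcₙ_le fun s hs => ?_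
    have hs0 := hspec s hs
    have e : s - s * μ s * s - s * μ s * s + s * μ s * s * μ s * s =
        s * (1 - s * κ s) * (1 - s * κ s) ^ 3 := by rw [hμs]; ring
    rw [e, Real.norm_of_nonneg (mul_nonneg (mul_nonneg hs0 (hu0 s)) (pow_nonneg (hu0 s) 3))]
    exact (mul_le_of_le_one_right (mul_nonneg hs0 (hu0 s))
      (pow_le_one₀ (hu0 s) (hu1 s))).trans (hsu s)

end Cutoff

/-! ### Approximate projections and reduction to extreme quasi-states. -/

namespace PreHilbertModule

variable {D : Type u} [NonUnitalCStarAlgebra D] {X : Type u} [AddCommGroup X] [Module ℂ X]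
  (S : PreHilbertModule D X)

theorem re_apply_inner_nonneg {φ : D → ℂ} (hφ : φ ∈ quasiStates D) (x : X) :
    0 ≤ (φ (S.inner x x)).re := by
  obtain ⟨b, hb⟩ := S.inner_self_nonneg x
  rw [hb]
  exact quasiStates.re_nonneg hφ b

/-- Moving `ξ` by an element of a submodule `F` such that `|ξ|` decreases and such that the new
distance to `0` is not much larger than that of `ξ` to a given element of `F`, in all
quasi-states. -/
theorem exists_approx_projection {F : Submodule ℂ X} (hF : ∀ x ∈ F, ∀ d, S.act x d ∈ F) (ξ : X)
    {f : X} (hf : f ∈ F) {ε : ℝ} (hε : 0 < ε) :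
    ∃ h ∈ F, ∀ φ ∈ quasiStates D,
      (φ (S.inner (ξ - h) (ξ - h))).re ≤ (φ (S.inner ξ ξ)).re ∧
      (φ (S.inner (ξ - h) (ξ - h))).re ≤ (φ (S.inner (ξ - f) (ξ - f))).re + ε := by
  let _ : PartialOrder D := CStarAlgebra.spectralOrder D
  have _ : StarOrderedRing D := CStarAlgebra.spectralOrderedRing D
  set x := ξ - f with hx
  have hξ : ξ = x + f := by rw [hx]; abel
  set G := S.inner f f with hGdef
  set c := S.inner f x with hc
  have hc' : S.inner x f = star c := by rw [hc, S.star_inner]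
  have hGs : star G = G := S.star_inner f f
  have hG : 0 ≤ G := CStarAlgebra.nonneg_iff_eq_star_mul_self.2 (S.inner_self_nonneg f)
  obtain ⟨δ, hδ, hδε⟩ : ∃ δ : ℝ, 0 < δ ∧ 2 * √(‖S.inner x x‖ * δ) + δ ≤ ε := by
    have ht : Filter.Tendsto (fun δ : ℝ => 2 * √(‖S.inner x x‖ * δ) + δ) (nhds 0)
        (nhds (2 * √(‖S.inner x x‖ * 0) + 0)) := by
      refine Continuous.tendsto (by fun_prop) 0
    simp only [mul_zero, Real.sqrt_zero, add_zero] at ht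
    have := ((ht.eventually_lt_const hε).filter_mono nhdsWithin_le_nhds).and
      (self_mem_nhdsWithin (s := Set.Ioi (0 : ℝ)))
    obtain ⟨δ, h1, h2⟩ := this.exists
    exact ⟨δ, h2, h1.le⟩
  obtain ⟨k, m, hk, hm, hm0, hn1, hn2⟩ := exists_cutoff hG hδ
  have hms : star m = m := (IsSelfAdjoint.of_nonneg hm0).star_eq
  have hks : star k = k := hk
  set e := S.inner f ξ with he
  have he' : S.inner ξ f = star e := by rw [he, S.star_inner]
  have hec : e = c + G := by rw [he, hξ, map_add]
  -- The correction is `h = f · k⟨f, ξ⟩`. As `m ≥ 0`, this identity already shows that the length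
  -- does not increase in any quasi-state.
  have hz : S.inner (ξ - S.act f (k * e)) (ξ - S.act f (k * e)) =
      S.inner ξ ξ - star e * m * e := by
    simp only [map_sub, LinearMap.sub_apply, S.inner_act, S.inner_act_left, ← he, he', ← hGdef,
      star_mul, hks, hm]
    noncomm_ring
  set y := f - S.act f (m * G) with hy
  have hyy : S.inner y y = G - G * m * G - G * m * G + G * m * G * m * G := by
    simp only [hy, map_sub, LinearMap.sub_apply, S.inner_act, S.inner_act_left, ← hGdef,
      star_mul, hms, hGs]
    noncomm_ring
  have hxy : S.inner x y = star c - star c * m * G := by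
    simp only [hy, map_sub, S.inner_act, hc', mul_assoc]
  have hyx : S.inner y x = c - G * m * c := by
    rw [← S.star_inner, hxy]
    simp [hms, hGs, mul_assoc]
  -- The same square, expanded around `x = ξ - f`. The term `-c⋆mc` only helps, and `y = f - f · mG`
  -- has `‖⟨y, y⟩‖ ≤ δ`. All remaining errors are bounded in norm, hence uniformly in `φ`.
  have hz2 : S.inner (ξ - S.act f (k * e)) (ξ - S.act f (k * e)) =
      S.inner x x - star c * m * c + (S.inner x y + S.inner y x + (G - G * m * G)) := by
    rw [hz, hxy, hyx, hec, star_add, hGs, hξ, S.inner_add_self, ← hc, hc', ← hGdef]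
    noncomm_ring
  have hconj : ∀ (a : D) {φ : D → ℂ}, φ ∈ quasiStates D → 0 ≤ (φ (star a * m * a)).re := by
    intro a φ hφ
    obtain ⟨b, hb⟩ := CStarAlgebra.nonneg_iff_eq_star_mul_self.1 hm0
    have : star a * m * a = star (b * a) * (b * a) := by
      rw [hb, star_mul]; simp only [mul_assoc]
    rw [this]
    exact quasiStates.re_nonneg hφ _
  have hcs : ‖S.inner x y‖ ≤ √(‖S.inner x x‖ * δ) := by
    refine Real.le_sqrt_of_sq_le ((S.cauchySchwarz x y).trans ?_)
    rw [hyy]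
    gcongr
  have hcs' : ‖S.inner y x‖ ≤ √(‖S.inner x x‖ * δ) := by
    rw [← S.star_inner, norm_star]
    exact hcs
  refine ⟨S.act f (k * e), hF f hf _, fun φ hφ => ⟨?_, ?_⟩⟩
  · rw [hz, quasiStates.map_sub hφ, Complex.sub_re]
    linarith [hconj e hφ]
  · rw [hz2, hφ.1, quasiStates.map_sub hφ, hφ.1, hφ.1]
    simp only [Complex.add_re, Complex.sub_re]
    linarith [hconj c hφ, quasiStates.re_le_norm hφ (S.inner x y),
      quasiStates.re_le_norm hφ (S.inner y x), quasiStates.re_le_norm hφ (G - G * m * G)]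

/-- The elements of `s` are treated one at a time. A later correction increases the length of the
difference in no quasi-state, so earlier estimates survive and the error `ε` does not accumulate. -/
theorem exists_approx_projection_finset {F : Submodule ℂ X}
    (hF : ∀ x ∈ F, ∀ d, S.act x d ∈ F) (ξ : X) (s : Finset F) {ε : ℝ} (hε : 0 < ε) :
    ∃ h ∈ F, ∀ φ ∈ quasiStates D, ∀ f ∈ s,
      (φ (S.inner (ξ - h) (ξ - h))).re ≤ (φ (S.inner (ξ - f) (ξ - f))).re + ε := by
  classical
  induction s using Finset.induction_on with
  | empty => exact ⟨0, F.zero_mem, fun φ _ f hf => by simp at hf⟩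
  | insert f s _ ih =>
    obtain ⟨h, hh, H⟩ := ih
    -- The target is `f - h`, because `(ξ - h) - (f - h) = ξ - f`.
    obtain ⟨h', hh', H'⟩ := S.exists_approx_projection hF (ξ - h) (F.sub_mem f.2 hh) hε
    refine ⟨h + h', F.add_mem hh hh', fun φ hφ g hg => ?_⟩
    rw [← sub_sub]
    rcases Finset.mem_insert.1 hg with rfl | hg
    · have := (H' φ hφ).2
      rwa [sub_sub_sub_cancel_right] at this
    · exact (H' φ hφ).1.trans (H φ hφ g hg)

/-- If `ξ` can be approximated by elements of `F` in each pure state, then it can be approximated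
in norm. -/
theorem exists_norm_lt_of_extreme {F : Submodule ℂ X} (hF : ∀ x ∈ F, ∀ d, S.act x d ∈ F) (ξ : X)
    (h : ∀ φ ∈ (quasiStates D).extremePoints ℝ, φ ≠ 0 → ∀ ε > 0, ∃ f ∈ F,
      (φ (S.inner (ξ - f) (ξ - f))).re < ε) {ε : ℝ} (hε : 0 < ε) :
    ∃ f ∈ F, ‖S.inner (ξ - f) (ξ - f)‖ < ε := by
  set q : F → (D → ℂ) → ℝ := fun f φ => (φ (S.inner (ξ - f) (ξ - f))).re with hq
  have hqc : ∀ f, Continuous (q f) := fun f => by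
    simp only [hq]
    fun_prop
  have hbdd : ∀ φ ∈ quasiStates D, BddBelow (Set.range fun f => q f φ) := fun φ hφ =>
    ⟨0, by rintro _ ⟨f, rfl⟩; exact S.re_apply_inner_nonneg hφ _⟩
  have hall : ∀ φ ∈ quasiStates D, ∀ ε > 0, ∃ f, q f φ < ε := by
    by_contra! hcon
    obtain ⟨φ₀, hφ₀, ε₀, hε₀, hlow⟩ := hcon
    let d : (D → ℂ) → ℝ := fun φ => ⨅ f, q f φ
    have hd0 : ∀ φ ∈ quasiStates D, ∀ f, d φ ≤ q f φ := fun φ hφ f => ciInf_le (hbdd φ hφ) f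
    have hdlt : ∀ φ (t : ℝ), d φ < t → ∃ f, q f φ < t := fun φ t ht =>
      exists_lt_of_ciInf_lt ht
    -- An infimum of continuous functions is upper semicontinuous, so it attains its maximum `M` on
    -- the compact set of quasi-states.
    have husc : UpperSemicontinuousOn d (quasiStates D) := by
      intro φ hφ t ht
      obtain ⟨f, hf⟩ := hdlt φ t ht
      have h1 : ∀ᶠ ψ in nhdsWithin φ (quasiStates D), q f ψ < t :=
        ((hqc f).continuousAt.eventually_lt_const hf).filter_mono nhdsWithin_le_nhds
      filter_upwards [h1, self_mem_nhdsWithin] with ψ h2 h3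
      exact (hd0 ψ h3 f).trans_lt h2
    obtain ⟨φ₁, hφ₁, hmax⟩ := husc.exists_isMaxOn ⟨φ₀, hφ₀⟩ isCompact_quasiStates
    set M := d φ₁ with hM
    have hM0 : 0 < M := hε₀.trans_le ((le_ciInf hlow).trans (hmax hφ₀))
    let Z : Set (D → ℂ) := quasiStates D ∩ ⋂ f, {φ | M ≤ q f φ}
    have hZ : IsCompact Z := isCompact_quasiStates.inter_right
      (isClosed_iInter fun f => isClosed_le continuous_const (hqc f))
    have hZmem : ∀ φ ∈ quasiStates D, φ ∈ Z ↔ M ≤ d φ := fun φ hφ => by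
      refine ⟨fun h => le_ciInf fun f => Set.mem_iInter.1 h.2 f, fun h => ⟨hφ, ?_⟩⟩
      exact Set.mem_iInter.2 fun f => h.trans (hd0 φ hφ f)
    -- Convexity of `d` enters here. Near-optimal `f` for `φ` and `g` for `ψ` are replaced by one
    -- `k` serving both. If `d φ < M`, then the value of `k` at the convex combination would fall
    -- below `M`.
    have hext : IsExtreme ℝ (quasiStates D) Z := by
      refine ⟨Set.inter_subset_left, ?_⟩
      rintro φ hφ ψ hψ χ hχ ⟨s, t, hs, ht, hst, rfl⟩
      rw [hZmem φ hφ]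
      by_contra! hlt
      have hψM : d ψ ≤ M := hmax hψ
      -- One `γ` is lost in the choice of `f` and `g` and one in passing to `k`. The gain `s(M - d
      -- φ) = 3γ` exceeds this loss of `2γ`.
      set γ := s * (M - d φ) / 3 with hγ
      have hγ0 : 0 < γ := by have := sub_pos.2 hlt; positivity
      obtain ⟨f, hf⟩ := hdlt φ (d φ + γ) (by linarith)
      obtain ⟨g, hg⟩ := hdlt ψ (d ψ + γ) (by linarith)
      classical
      obtain ⟨k, hk, hkH⟩ := S.exists_approx_projection_finset hF ξ {f, g} hγ0
      have h1 := hkH φ hφ f (by simp)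
      have h2 := hkH ψ hψ g (by simp)
      have h3 : M ≤ q ⟨k, hk⟩ (s • φ + t • ψ) := Set.mem_iInter.1 hχ.2 ⟨k, hk⟩
      have h4 : q ⟨k, hk⟩ (s • φ + t • ψ) = s * q ⟨k, hk⟩ φ + t * q ⟨k, hk⟩ ψ := by
        simp [hq]
      have h5 : q ⟨k, hk⟩ φ ≤ d φ + γ + γ := h1.trans (by linarith)
      have h6 : q ⟨k, hk⟩ ψ ≤ M + γ + γ := h2.trans (by linarith)
      have h7 : s * q ⟨k, hk⟩ φ ≤ s * (d φ + γ + γ) := by gcongr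
      have h8 : t * q ⟨k, hk⟩ ψ ≤ t * (M + γ + γ) := by gcongr
      have h9 : s * (d φ + γ + γ) + t * (M + γ + γ) = M - s * (M - d φ) + 2 * γ := by
        have : t = 1 - s := by linarith
        rw [this]; ring
      have h10 : s * (M - d φ) = 3 * γ := by rw [hγ]; ring
      linarith
    -- Krein–Milman for the compact set of maximisers. An extreme point of an extreme subset is
    -- extreme in the whole set, and it is nonzero because all distances vanish at the zero
    -- functional.
    obtain ⟨φ, hφ⟩ := hZ.extremePoints_nonempty ⟨φ₁, (hZmem φ₁ hφ₁).2 le_rfl⟩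
    have hφ' := hext.extremePoints_subset_extremePoints hφ
    have hφZ := extremePoints_subset hφ
    have hne : φ ≠ 0 := by
      rintro rfl
      have : M ≤ q 0 0 := Set.mem_iInter.1 hφZ.2 0
      simp only [hq, Pi.zero_apply, Complex.zero_re] at this
      linarith
    obtain ⟨f, hf, hlt⟩ := h φ hφ' hne M hM0
    have : M ≤ q ⟨f, hf⟩ φ := Set.mem_iInter.1 hφZ.2 ⟨f, hf⟩
    simp only [hq] at this
    linarith
  have hcover : quasiStates D ⊆ ⋃ f, {φ | q f φ < ε / 2} := fun φ hφ =>
    Set.mem_iUnion.2 (hall φ hφ (ε / 2) (by positivity))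
  -- Finitely many `f` suffice for all quasi-states up to `ε / 2`, and a common `k` costs another `ε
  -- / 3`. A quasi-state that attains the norm turns this into a norm estimate.
  obtain ⟨s, hs⟩ := isCompact_quasiStates.elim_finite_subcover _
    (fun f => isOpen_lt (hqc f) continuous_const) hcover
  obtain ⟨k, hk, hkH⟩ := S.exists_approx_projection_finset hF ξ s (ε := ε / 3) (by positivity)
  refine ⟨k, hk, ?_⟩
  obtain ⟨b, hb⟩ := S.inner_self_nonneg (ξ - k)
  obtain ⟨φ, hφ, hφb⟩ := exists_quasiState_apply_eq_norm b
  obtain ⟨f, hfs, hf⟩ := Set.mem_iUnion₂.1 (hs hφ)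
  have h1 := hkH φ hφ f hfs
  rw [hb, hφb, Complex.ofReal_re] at h1
  have h2 : (φ (S.inner (ξ - f) (ξ - f))).re < ε / 2 := hf
  rw [hb]
  linarith

end PreHilbertModule

/-! ### Elementary tensors in the interior tensor product. -/

section InteriorTensor

variable {D₁ D₂ : Type u} [NonUnitalCStarAlgebra D₁] [NonUnitalCStarAlgebra D₂]
  {E : HilbertModule D₁} {F : HilbertModule D₂} (G : Correspondence D₁ F)

theorem norm_toInterior_tmul_sq (ξ : E) (η : F) :
    ‖toInterior E G (ξ ⊗ₜ η)‖ ^ 2 = ‖F.inner η (G.left (E.inner ξ ξ) η)‖ :=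
  (tensorPre E G).norm_toCompletion_sq (ξ ⊗ₜ η)

theorem toInterior_sub_tmul (ξ ξ' : E) (η : F) : toInterior E G ((ξ - ξ') ⊗ₜ η) =
    toInterior E G (ξ ⊗ₜ η) - toInterior E G (ξ' ⊗ₜ η) := by
  rw [TensorProduct.sub_tmul, map_sub]

theorem continuous_toInterior_tmul_right (ξ : E) :
    Continuous fun η : F => toInterior E G (ξ ⊗ₜ η) := by
  let f : F →ₗ[ℂ] interiorTensor E G := toInterior E G ∘ₗ TensorProduct.mk ℂ E F ξ
  have h : ∀ η, ‖f η‖ ≤ √‖G.left (E.inner ξ ξ)‖ * ‖η‖ := fun η => by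
    refine le_of_sq_le_sq ?_ (by positivity)
    rw [mul_pow, Real.sq_sqrt (norm_nonneg _)]
    refine (norm_toInterior_tmul_sq G ξ η).trans_le ((F.norm_inner_le _ _).trans ?_)
    calc ‖η‖ * ‖G.left (E.inner ξ ξ) η‖ ≤ ‖η‖ * (‖G.left (E.inner ξ ξ)‖ * ‖η‖) := by
          gcongr
          exact (G.left (E.inner ξ ξ)).le_opNorm η
      _ = ‖G.left (E.inner ξ ξ)‖ * ‖η‖ ^ 2 := by ring
  exact (LinearMap.mkContinuous f _ h).continuous

/-- The algebraic tensor product is taken over `ℂ`, so balancing over `D₁` is not built in. It holds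
because the difference has zero inner square, and such vectors die in the Hausdorff completion. -/
theorem toInterior_tmul_left (ξ : E) (d : D₁) (η : F) :
    toInterior E G (ξ ⊗ₜ G.left d η) = toInterior E G (E.act ξ d ⊗ₜ η) := by
  rw [← sub_eq_zero, ← map_sub, ← norm_eq_zero, ← sq_eq_zero_iff]
  refine ((tensorPre E G).norm_toCompletion_sq _).trans (norm_eq_zero.2 ?_)
  change tensorForm E G _ _ = 0
  simp only [map_sub, LinearMap.sub_apply, tensorForm_tmul, E.inner_act, E.inner_act_left,
    G.inner_left, map_mul, mul_apply_eq_comp]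
  abel

end InteriorTensor

/-! ### The Hilbert module structure on finite powers. -/

section Power

variable {D : Type u} [NonUnitalCStarAlgebra D] (E : HilbertModule D) (n : ℕ)

/-- The inner product `⟨x, y⟩ = ∑ₖ ⟨xₖ, yₖ⟩` on `Eⁿ`. -/
def powPre : PreHilbertModule D (Fin n → E) where
  act x d k := E.act (x k) d
  inner := LinearMap.mk₂'ₛₗ (starRingEnd ℂ) (RingHom.id ℂ) (fun x y => ∑ k, E.inner (x k) (y k))
    (fun x y z => by simp [Finset.sum_add_distrib])
    (fun c x y => by simp [Finset.smul_sum])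
    (fun x y z => by simp [Finset.sum_add_distrib])
    (fun c x y => by simp [Finset.smul_sum])
  inner_act x y d := by
    simp [E.inner_act, Finset.sum_mul]
  star_inner x y := by
    simp [E.star_inner]
  inner_self_nonneg x := by
    let _ : PartialOrder D := CStarAlgebra.spectralOrder D
    have _ : StarOrderedRing D := CStarAlgebra.spectralOrderedRing D
    rw [← CStarAlgebra.nonneg_iff_eq_star_mul_self]
    change 0 ≤ ∑ k, E.inner (x k) (x k)
    exact Finset.sum_nonneg fun i _ =>
      CStarAlgebra.nonneg_iff_eq_star_mul_self.2 (E.inner_self_nonneg _)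

theorem powPre_inner (x y : Fin n → E) :
    (powPre E n).inner x y = ∑ k, E.inner (x k) (y k) := rfl

/-- A positive summand is dominated by the sum. This translates estimates for the module inner
product into the supremum norm of `Fin n → E`, in which submodules are required to be closed. -/
theorem norm_apply_sq_le (x : Fin n → E) (k : Fin n) :
    ‖x k‖ ^ 2 ≤ ‖(powPre E n).inner x x‖ := by
  let _ : PartialOrder D := CStarAlgebra.spectralOrder D
  have _ : StarOrderedRing D := CStarAlgebra.spectralOrderedRing D
  have hpos : ∀ j, 0 ≤ E.inner (x j) (x j) := fun j =>
    CStarAlgebra.nonneg_iff_eq_star_mul_self.2 (E.inner_self_nonneg _)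
  rw [E.norm_sq, powPre_inner]
  exact CStarAlgebra.norm_le_norm_of_nonneg_of_le (hpos k)
    (Finset.single_le_sum (f := fun j => E.inner (x j) (x j)) (fun j _ => hpos j)
      (Finset.mem_univ k))

end Power

/-! ### Detecting Hilbert submodules by irreducible representations. -/

section LocalGlobal

variable {D : Type u} [NonUnitalCStarAlgebra D] {E : HilbertModule D} {n : ℕ}

/-- In the presence of a cyclic vector `η`, the elements `f ⊗ η` with `f ∈ F` are dense in the
tensor product of `F` with the correspondence. -/
theorem exists_norm_toInterior_sub_lt_of_cyclic {D' : Type u} [NonUnitalCStarAlgebra D']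
    {F' : HilbertModule D'} (G : Correspondence D F') {η : F'}
    (hη : DenseRange fun d => G.left d η) {F : Submodule ℂ (Fin n → E)}
    (hF : ∀ ξ ∈ F, ∀ d, (fun k => E.act (ξ k) d) ∈ F) {ξ : Fin n → E}
    (hξ : (fun k => toInterior E G (ξ k ⊗ₜ η)) ∈
      (Submodule.span ℂ {ζ : Fin n → interiorTensor E G | ∃ f ∈ F, ∃ θ : F',
        ζ = fun k => toInterior E G (f k ⊗ₜ θ)}).topologicalClosure) {δ : ℝ} (hδ : 0 < δ) :
    ∃ f ∈ F, ∀ k, ‖toInterior E G ((ξ k - f k) ⊗ₜ η)‖ < δ := by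
  let L : (Fin n → E) →ₗ[ℂ] (Fin n → interiorTensor E G) := LinearMap.pi fun k =>
    toInterior E G ∘ₗ (TensorProduct.mk ℂ E F').flip η ∘ₗ LinearMap.proj k
  have hL : ∀ f k, L f k = toInterior E G (f k ⊗ₜ η) := fun _ _ => rfl
  -- Each `θ` is a limit of vectors `d · η`, and `f ⊗ dη = fd ⊗ η` with `fd ∈ F`. Thus every
  -- generator is a limit of tensors with the single vector `η`.
  have hle : (Submodule.span ℂ {ζ : Fin n → interiorTensor E G | ∃ f ∈ F, ∃ θ : F',
      ζ = fun k => toInterior E G (f k ⊗ₜ θ)}).topologicalClosure ≤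
      (F.map L).topologicalClosure := by
    refine Submodule.topologicalClosure_minimal _ (Submodule.span_le.2 ?_)
      (Submodule.isClosed_topologicalClosure _)
    rintro _ ⟨f, hf, θ, rfl⟩
    have hcl : IsClosed {θ : F' | (fun k => toInterior E G (f k ⊗ₜ θ)) ∈
        (F.map L).topologicalClosure} :=
      (Submodule.isClosed_topologicalClosure (F.map L)).preimage
        (continuous_pi fun k => continuous_toInterior_tmul_right G (f k))
    refine closure_minimal ?_ hcl (hη θ)
    rintro _ ⟨d, rfl⟩
    refine Submodule.le_topologicalClosure _ ⟨_, hF f hf d, ?_⟩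
    funext k
    exact (toInterior_tmul_left G (f k) d η).symm
  have hmem := hle hξ
  rw [← SetLike.mem_coe, Submodule.topologicalClosure_coe, Metric.mem_closure_iff] at hmem
  obtain ⟨_, ⟨f, hf, rfl⟩, hdist⟩ := hmem δ hδ
  refine ⟨f, hf, fun k => ?_⟩
  have := (dist_pi_lt_iff hδ).1 hdist k
  rwa [dist_eq_norm, hL, ← toInterior_sub_tmul] at this

theorem norm_toInterior_ofRep_sq {H : Type u} [NormedAddCommGroup H] [InnerProductSpace ℂ H]
    [CompleteSpace H] (ρ : D →⋆ₙₐ[ℂ] (H →L[ℂ] H)) (hρ : IsNondegenerate ρ) (x : E)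
    (η : ofHilbertSpace H) :
    ‖toInterior E (Correspondence.ofRep ρ hρ) (x ⊗ₜ η)‖ ^ 2 =
      ‖inner (E := H) ℂ η (ρ (E.inner x x) η)‖ :=
  norm_toInterior_tmul_sq (Correspondence.ofRep ρ hρ) x η

/-- The local–global principle for Hilbert submodules: they may be compared after tensoring with
irreducible representations. -/
theorem submodule_le_of_irreducible {F₁ F₂ : Submodule ℂ (Fin n → E)}
    (hcl : IsClosed (F₂ : Set (Fin n → E)))
    (hact : ∀ ξ ∈ F₂, ∀ d, (fun k => E.act (ξ k) d) ∈ F₂)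
    (h : ∀ (H : Type u) [NormedAddCommGroup H] [InnerProductSpace ℂ H] [CompleteSpace H]
      (ρ : D →⋆ₙₐ[ℂ] (H →L[ℂ] H)) (hρ : IsNondegenerate ρ), IsIrreducible ρ →
      ∀ ξ ∈ F₁, ∀ θ : ofHilbertSpace H,
        (fun k => toInterior E (Correspondence.ofRep ρ hρ) (ξ k ⊗ₜ θ)) ∈
          (Submodule.span ℂ {ζ : Fin n → interiorTensor E (Correspondence.ofRep ρ hρ) |
            ∃ ξ ∈ F₂, ∃ θ : ofHilbertSpace H, ζ = fun k =>
              toInterior E (Correspondence.ofRep ρ hρ) (ξ k ⊗ₜ θ)}).topologicalClosure) :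
    F₁ ≤ F₂ := by
  intro ξ hξ
  have hpure : ∀ φ ∈ (quasiStates D).extremePoints ℝ, φ ≠ 0 → ∀ ε > 0, ∃ f ∈ F₂,
      (φ ((powPre E n).inner (ξ - f) (ξ - f))).re < ε := by
    intro φ hφ hφ0 ε hε
    obtain ⟨H, _, _, _, ρ, η, hd, hη, hφη⟩ := exists_cyclic_rep hφ.1
    have hρ := isNondegenerate_of_cyclic hd
    have hirr := isIrreducible_of_extreme hφ hφ0 hd hη hφη
    -- The `n` coordinates contribute at most `ε / (n + 1)` each. Using `n + 1` keeps the sum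
    -- strictly below `ε` and also covers `n = 0`.
    have hδ : 0 < √(ε / (n + 1)) := Real.sqrt_pos.2 (by positivity)
    obtain ⟨f, hf, hdist⟩ := exists_norm_toInterior_sub_lt_of_cyclic
      (Correspondence.ofRep ρ hρ) hd hact (h H ρ hρ hirr ξ hξ η) hδ
    refine ⟨f, hf, ?_⟩
    -- The distance in the state is the distance in the tensor product: `φ(⟨x, x⟩) = ⟨η, ρ(⟨x,
    -- x⟩)η⟩`, which has absolute value `‖x ⊗ η‖²`.
    have hk : ∀ k, (φ (E.inner ((ξ - f) k) ((ξ - f) k))).re ≤ ε / (n + 1) := by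
      intro k
      refine (Complex.re_le_norm _).trans ?_
      rw [hφη, Pi.sub_apply]
      refine (norm_toInterior_ofRep_sq ρ hρ (ξ k - f k) η).symm.trans_le ?_
      refine (pow_le_pow_left₀ (norm_nonneg _) (hdist k).le 2).trans_eq ?_
      exact Real.sq_sqrt (by positivity)
    have hsum : φ ((powPre E n).inner (ξ - f) (ξ - f)) =
        ∑ k, φ (E.inner ((ξ - f) k) ((ξ - f) k)) := by
      rw [powPre_inner]
      exact map_sum (quasiStates.toLinearMap hφ.1) _ _
    rw [hsum, Complex.re_sum]
    calc ∑ k, (φ (E.inner ((ξ - f) k) ((ξ - f) k))).re ≤ ∑ _k : Fin n, ε / (n + 1) :=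
          Finset.sum_le_sum fun k _ => hk k
      _ = n * (ε / (n + 1)) := by simp
      _ < ε := by
        rw [mul_div_assoc', div_lt_iff₀ (by positivity)]
        nlinarith
  rw [← SetLike.mem_coe, ← hcl.closure_eq, Metric.mem_closure_iff]
  intro ε hε
  obtain ⟨f, hf, hlt⟩ := (powPre E n).exists_norm_lt_of_extreme hact ξ hpure
    (show 0 < ε ^ 2 by positivity)
  refine ⟨f, hf, (dist_pi_lt_iff hε).2 fun k => ?_⟩
  rw [dist_eq_norm]
  exact lt_of_pow_lt_pow_left₀ 2 hε.le ((norm_apply_sq_le E n (ξ - f) k).trans_lt hlt)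

end LocalGlobal

/-! ### Recovering summands from Hilbert module direct sums. -/

section DirectSum

variable {D : Type u} [NonUnitalCStarAlgebra D] {ι : Type u} (E : ι → HilbertModule D)

theorem norm_apply_le_norm_toDirectSum (x : Π₀ i, E i) (i : ι) : ‖x i‖ ≤ ‖toDirectSum E x‖ := by
  let _ : PartialOrder D := CStarAlgebra.spectralOrder D
  have _ : StarOrderedRing D := CStarAlgebra.spectralOrderedRing D
  refine le_of_sq_le_sq ?_ (norm_nonneg _)
  refine ((E i).norm_sq _).trans_le (le_of_le_of_eq ?_
    ((directSumPre E).norm_toCompletion_sq x).symm)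
  have hpos : ∀ j, 0 ≤ (E j).inner (x j) (x j) := fun j =>
    CStarAlgebra.nonneg_iff_eq_star_mul_self.2 ((E j).inner_self_nonneg _)
  exact CStarAlgebra.norm_le_norm_of_nonneg_of_le (hpos i)
    (single_le_finsum i (finite_support_inner E x x) hpos)

/-- The projection of a direct sum onto a summand. -/
theorem exists_projection (i : ι) : ∃ p : directSumModule E →L[ℂ] E i,
    (∀ x, p (inclusion E i x) = x) ∧ ∀ j, j ≠ i → ∀ x, p (inclusion E j x) = 0 := by
  classical
  let ev : (Π₀ i, E i) →ₗ[ℂ] E i := DFinsupp.lapply i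
  let l : (directSumPre E).Space →L[ℂ] E i := LinearMap.mkContinuous
    (show (directSumPre E).Space →ₗ[ℂ] E i from ev) 1 fun x => by
      rw [one_mul]
      refine (norm_apply_le_norm_toDirectSum E x i).trans_eq ?_
      exact UniformSpace.Completion.norm_coe (E := (directSumPre E).Space) x
  let p : directSumModule E →L[ℂ] E i := l.extend UniformSpace.Completion.toComplL
  have hp : ∀ x : Π₀ i, E i, p (toDirectSum E x) = x i := fun x =>
    ContinuousLinearMap.extend_eq l UniformSpace.Completion.denseRange_coe
      (UniformSpace.Completion.isUniformInducing_coe (directSumPre E).Space) x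
  refine ⟨p, fun x => (hp _).trans ?_, fun j hj x => (hp _).trans ?_⟩
  · rw [DFinsupp.lsingle_apply]
    convert DFinsupp.single_eq_same
  · rw [DFinsupp.lsingle_apply]
    convert DFinsupp.single_eq_of_ne hj.symm

/-- A summand of a direct sum of closed submodules of the powers `Eᵢⁿ` can be recovered from the
direct sum. -/
theorem submodule_le_of_directSum {n : ℕ} {F₁ F₂ : ∀ i, Submodule ℂ (Fin n → E i)}
    (hcl : ∀ i, IsClosed (F₂ i : Set (Fin n → E i)))
    (h : (Submodule.span ℂ {ζ : Fin n → directSumModule E |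
        ∃ i, ∃ ξ ∈ F₁ i, ζ = fun k => inclusion E i (ξ k)}).topologicalClosure ≤
      (Submodule.span ℂ {ζ : Fin n → directSumModule E |
        ∃ i, ∃ ξ ∈ F₂ i, ζ = fun k => inclusion E i (ξ k)}).topologicalClosure) (i : ι) :
    F₁ i ≤ F₂ i := by
  obtain ⟨p, hp, hp0⟩ := exists_projection E i
  let P : (Fin n → directSumModule E) →L[ℂ] (Fin n → E i) :=
    ContinuousLinearMap.pi fun k => p ∘L ContinuousLinearMap.proj k
  -- The coordinate projection sends the generators from summand `i` back into `F₂ i` and kills all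
  -- others. As `F₂ i` is closed, the whole closed span lands in it.
  have hle : (Submodule.span ℂ {ζ : Fin n → directSumModule E |
        ∃ i, ∃ ξ ∈ F₂ i, ζ = fun k => inclusion E i (ξ k)}).topologicalClosure ≤
      (F₂ i).comap P.toLinearMap := by
    refine Submodule.topologicalClosure_minimal _ (Submodule.span_le.2 ?_)
      ((hcl i).preimage P.continuous)
    rintro _ ⟨j, ξ, hξ, rfl⟩
    by_cases hj : j = i
    · subst hj
      have : P (fun k => inclusion E j (ξ k)) = ξ := funext fun k => hp (ξ k)
      change P _ ∈ F₂ j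
      rwa [this]
    · have : P (fun k => inclusion E j (ξ k)) = 0 := funext fun k => hp0 j hj (ξ k)
      change P _ ∈ F₂ i
      rw [this]
      exact (F₂ i).zero_mem
  intro ξ hξ
  have hmem := hle (h (Submodule.le_topologicalClosure _
    (Submodule.subset_span ⟨i, ξ, hξ, rfl⟩)))
  have : P (fun k => inclusion E i (ξ k)) = ξ := funext fun k => hp (ξ k)
  change P _ ∈ F₂ i at hmem
  rwa [this] at hmem

end DirectSum

/-! ### Inheritance of the Strong Local–Global Principle. -/

section Classes

variable {A : Type v} [Ring A] [StarRing A] [Algebra ℂ A]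

/-- Each naturality clause expresses the submodule of the new representation through those of the
old ones, so equalities are transported. Only the passage to direct summands reverses this, and
there the projections of `submodule_le_of_directSum` are needed. -/
theorem RepClass.DefinedBySubmoduleCondition.weaklyAdmissible {R R' : RepClass.{u} A}
    (h : R.DefinedBySubmoduleCondition R') (hR : R.WeaklyAdmissible) : R'.WeaklyAdmissible := by
  obtain ⟨n, -, F₁, F₂, hF⟩ := h
  refine ⟨?_, ?_, ?_⟩
  · intro D _ E₁ E₂ π₁ π₂ U h
    obtain ⟨h₁, heq⟩ := (hF _ _ _).1 h
    have h₂ := hR.unitary U h₁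
    refine (hF _ _ _).2 ⟨h₂, SetLike.coe_injective ?_⟩
    rw [← F₁.unitary U h₁ h₂, ← F₂.unitary U h₁ h₂, heq]
  · intro D₁ D₂ _ _ E F G π h
    obtain ⟨h₁, heq⟩ := (hF _ _ _).1 h
    have h₂ := hR.tensor G π h₁
    refine (hF _ _ _).2 ⟨h₂, ?_⟩
    rw [F₁.tensor G π h₁ h₂, F₂.tensor G π h₁ h₂, heq]
  · intro D _ ι E π
    constructor
    · intro h i
      obtain ⟨h₁, heq⟩ := (hF _ _ _).1 h
      have h₂ := (hR.directSum π).1 h₁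
      rw [F₁.directSum π h₂ h₁, F₂.directSum π h₂ h₁] at heq
      exact (hF _ _ _).2 ⟨h₂ i, le_antisymm
        (submodule_le_of_directSum E (F₁ := fun i => F₁.obj (π i) (h₂ i))
          (fun i => F₂.isClosed (π i) (h₂ i)) heq.le i)
        (submodule_le_of_directSum E (F₁ := fun i => F₂.obj (π i) (h₂ i))
          (fun i => F₁.isClosed (π i) (h₂ i)) heq.ge i)⟩
    · intro h
      have h₁ : ∀ i, R D (E i) (π i) := fun i => ((hF _ _ _).1 (h i)).1
      have heq : ∀ i, F₁.obj (π i) (h₁ i) = F₂.obj (π i) (h₁ i) := fun i =>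
        ((hF _ _ _).1 (h i)).2
      have h₂ := (hR.directSum π).2 h₁
      refine (hF _ _ _).2 ⟨h₂, ?_⟩
      rw [F₁.directSum π h₁ h₂, F₂.directSum π h₁ h₂]
      simp only [heq]

theorem RepClass.DefinedBySubmoduleCondition.strongLocalGlobalPrinciple {R R' : RepClass.{u} A}
    (h : R.DefinedBySubmoduleCondition R') (hR : R.StrongLocalGlobalPrinciple) :
    R'.StrongLocalGlobalPrinciple := by
  have hw := h.weaklyAdmissible hR.1
  refine ⟨hw, fun D _ E π => ⟨fun hπ H _ _ _ ρ hρ _ => hw.tensor _ _ hπ, fun hπ => ?_⟩⟩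
  obtain ⟨n, -, F₁, F₂, hF⟩ := h
  -- The principle for the larger class comes first: without membership in `R`, the submodules
  -- attached to `π` are not defined.
  have hR' : R D E π := (hR.2 D E π).2 fun H _ _ _ ρ hρ hirr =>
    ((hF _ _ _).1 (hπ H ρ hρ hirr)).1
  refine (hF _ _ _).2 ⟨hR', le_antisymm ?_ ?_⟩
  · refine submodule_le_of_irreducible (F₂.isClosed π hR') (F₂.act_mem π hR') ?_
    intro H _ _ _ ρ hρ hirr ξ hξ θ
    obtain ⟨h₂, heq⟩ := (hF _ _ _).1 (hπ H ρ hρ hirr)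
    rw [← F₂.tensor _ π hR' h₂, ← heq, F₁.tensor _ π hR' h₂]
    exact Submodule.le_topologicalClosure _ (Submodule.subset_span ⟨ξ, hξ, θ, rfl⟩)
  · refine submodule_le_of_irreducible (F₁.isClosed π hR') (F₁.act_mem π hR') ?_
    intro H _ _ _ ρ hρ hirr ξ hξ θ
    obtain ⟨h₂, heq⟩ := (hF _ _ _).1 (hπ H ρ hρ hirr)
    rw [← F₁.tensor _ π hR' h₂, heq, F₂.tensor _ π hR' h₂]
    exact Submodule.le_topologicalClosure _ (Submodule.subset_span ⟨ξ, hξ, θ, rfl⟩)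

/-- The class of all representations satisfies the Strong Local–Global Principle. -/
theorem RepClass.strongLocalGlobalPrinciple_of_forall {R : RepClass.{u} A}
    (h : ∀ (D : Type u) [NonUnitalCStarAlgebra D] (E : HilbertModule D) (π : ClosedRep A E),
      R D E π) : R.StrongLocalGlobalPrinciple :=
  ⟨⟨fun _ _ => h _ _ _, fun _ _ _ => h _ _ _, fun _ => ⟨fun _ _ => h _ _ _, fun _ => h _ _ _⟩⟩,
    fun _ _ _ _ => ⟨fun _ _ _ _ _ _ _ _ => h _ _ _, fun _ => h _ _ _⟩⟩

/-- The Strong Local–Global Principle is inherited by intersections. -/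
theorem RepClass.strongLocalGlobalPrinciple_of_iff_forall {R : RepClass.{u} A} {J : Type*}
    {C : J → RepClass.{u} A} (hC : ∀ j, (C j).StrongLocalGlobalPrinciple)
    (h : ∀ (D : Type u) [NonUnitalCStarAlgebra D] (E : HilbertModule D) (π : ClosedRep A E),
      R D E π ↔ ∀ j, C j D E π) : R.StrongLocalGlobalPrinciple := by
  have hw : R.WeaklyAdmissible := by
    refine ⟨?_, ?_, ?_⟩
    · intro D _ E₁ E₂ π₁ π₂ U hπ
      exact (h _ _ _).2 fun j => (hC j).1.unitary U ((h _ _ _).1 hπ j)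
    · intro D₁ D₂ _ _ E F G π hπ
      exact (h _ _ _).2 fun j => (hC j).1.tensor G π ((h _ _ _).1 hπ j)
    · intro D _ ι E π
      simp only [h, (hC _).1.directSum]
      exact forall_comm
  refine ⟨hw, fun D _ E π => ⟨fun hπ H _ _ _ ρ hρ _ => hw.tensor _ _ hπ, fun hπ => ?_⟩⟩
  exact (h _ _ _).2 fun j => ((hC j).2 D E π).2 fun H _ _ _ ρ hρ hirr =>
    (h _ _ _).1 (hπ H ρ hρ hirr) j

end Classes

end StarRep

end

/-- If a class of representations of a unital ⋆-algebra `A` is defined by submodule conditions, then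
it satisfies the Strong Local–Global Principle. -/
theorem mainTheorem2 {A : Type v} [Ring A] [StarRing A] [Algebra ℂ A] [StarModule ℂ A]
    (R : StarRep.RepClass.{u, v} A)
    (hR : StarRep.RepClass.DefinedBySubmoduleConditions.{u, v, w} R) :
    R.StrongLocalGlobalPrinciple := by
  obtain ⟨I, _, _, _, _, C, hbot, rfl, hsucc, hlim⟩ := hR
  suffices h : ∀ i, (C i).StrongLocalGlobalPrinciple from h ⊤
  intro i
  induction i using WellFoundedLT.induction with
  | ind i ih =>
    -- An element of the well-ordered set is a limit, the least element, or covers some `j`. These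
    -- cases use intersections, the class of all representations, and a submodule condition,
    -- respectively.
    by_cases hi : Order.IsSuccLimit i
    · exact StarRep.RepClass.strongLocalGlobalPrinciple_of_iff_forall
        (C := fun j : Set.Iio i => C j) (fun j => ih j j.2) fun D _ E π =>
          (hlim i hi D E π).trans ⟨fun h j => h j j.2, fun h j hj => h ⟨j, hj⟩⟩
    · rw [Order.not_isSuccLimit_iff] at hi
      rcases hi with hi | hi
      · obtain rfl := isMin_iff_eq_bot.1 hi
        exact StarRep.RepClass.strongLocalGlobalPrinciple_of_forall hbot
      · obtain ⟨j, hj⟩ := Order.not_isSuccPrelimit_iff.1 hi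
        exact (hsucc j i hj).strongLocalGlobalPrinciple (ih j hj.lt)
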